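/- Let $m\ge 1$ and $n\ge 0$ be integers and put $M=m-2n$. Let $\mathcal P=\mathbb R[x_1,\dots,x_m]\otimes\Lambda_{2n}$ be the space of real superpolynomials on $\mathbb R^{m|2n}$, where $\Lambda_{2n}$ is the real Grassmann algebra on the anticommuting generators $\theta_1,\dots,\theta_{2n}$. Write $(X_1,\dots,X_{m+2n})=(x_1,\dots,x_m,\theta_1,\dots,\theta_{2n})$ with parities $[a]=0$ for $a\le m$ and $[a]=1$ for $a>m$, and set $$R^2=\sum_{i=1}^m x_i^2-\sum_{j=1}^n\theta_{2j-1}\theta_{2j},\qquad \nabla^2=\sum_{i=1}^m\partial_{x_i}^2-4\sum_{j=1}^n\partial_{\theta_{2j-1}}\partial_{\theta_{2j}},\qquad \mathbb E=\sum_{a=1}^{m+2n} X_a\partial_{X_a},$$ $\mathcal P_k=\{f\in\mathcal P:\mathbb E f=kf\}$ and $\mathcal H_k=\mathcal P_k\cap\ker\nabla^2$. The Lie superalgebra $\mathfrak{osp}(m|2n)$ acts on $\mathcal P$ through the operators $L_{ab}=X_a\partial_{X^b}-(-1)^{[a][b]}X_b\partial_{X^a}$, where $\partial_{X^i}=\partial_{x_i}$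 for $i\le m$, $\partial_{X^{m+2j-1}}=2\partial_{\theta_{2j}}$ and $\partial_{X^{m+2j}}=-2\partial_{\theta_{2j-1}}$ for $1\le j\le n$. These operators commute with $R^2$, $\nabla^2$ and $\mathbb E$, so $\mathcal P_k$, $\mathcal H_k$ and $R^2\mathcal P_{k-2}\cap\mathcal H_k$ are $\mathfrak{osp}(m|2n)$-modules. Suppose that $M\in-2\mathbb N=\{0,-2,-4,\dots\}$ and that $k$ is an integer with $2-\tfrac M2\le k\le 2-M$. Then: 1. $R^{2k+M-2}\mathcal H_{2-M-k}$ is the maximal $\mathfrak{osp}(m|2n)$-submodule of $\mathcal H_k$: it is a proper submodule of $\mathcal H_k$, and every proper linear subspace of $\mathcal H_k$ that is stable under $\mathfrak{osp}(m|2n)$ is contained in it. It is moreover $\mathbb Z/2$-graded. 2. $R^2\mathcal P_{k-2}\cap\mathcal H_k=R^{2k+M-2}\mathcal H_{2-M-k}$. 3. The $\mathfrak{osp}(m|2n)$-module $\mathcal H_k/(R^2\mathcal P_{k-2}\cap\mathcal H_k)$ is irreducible. -/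

import Mathlib

open scoped TensorProduct

/-- The superpolynomials `ℝ[x₁,…,x_m] ⊗ Λ_{2n}` on `ℝ^{m|2n}`.  The `2n` anticommuting generators are
indexed by `Fin 2 × Fin n`: with `j` running through `Fin n`, the generator with index `(0, j)` is the
first and the one with index `(1, j)` the second member of the `j`-th symplectic pair. -/
def SuperPoly (m n : ℕ) : Type :=
  MvPolynomial (Fin m) ℝ ⊗[ℝ] ExteriorAlgebra ℝ (Fin 2 × Fin n → ℝ)

noncomputable instance SuperPoly.instAddCommGroup (m n : ℕ) : AddCommGroup (SuperPoly m n) :=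
  inferInstanceAs
    (AddCommGroup (MvPolynomial (Fin m) ℝ ⊗[ℝ] ExteriorAlgebra ℝ (Fin 2 × Fin n → ℝ)))

noncomputable instance SuperPoly.instModule (m n : ℕ) : Module ℝ (SuperPoly m n) :=
  inferInstanceAs
    (Module ℝ (MvPolynomial (Fin m) ℝ ⊗[ℝ] ExteriorAlgebra ℝ (Fin 2 × Fin n → ℝ)))

/-- Indices of the coordinates of `ℝ^{m|2n}`: `Sum.inl` even (bosonic), `Sum.inr` odd (fermionic). -/
abbrev SuperIdx (m n : ℕ) : Type := Fin m ⊕ (Fin 2 × Fin n)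

namespace SuperPoly

noncomputable section

/-- The superdimension `M = m - 2n`. -/
def superDim (m n : ℕ) : ℤ := (m : ℤ) - 2 * (n : ℤ)

variable {m n : ℕ}

/-- The superpolynomial `p ⊗ w`. -/
def tmul (p : MvPolynomial (Fin m) ℝ) (w : ExteriorAlgebra ℝ (Fin 2 × Fin n → ℝ)) :
    SuperPoly m n := p ⊗ₜ[ℝ] w

/-- The sign `(-1)^{[a][b]}`. -/
def sgn : SuperIdx m n → SuperIdx m n → ℝ
  | Sum.inr _, Sum.inr _ => -1
  | _, _ => 1

/-- Left multiplication by the coordinate `X_a`: by the polynomial variable `x_a` on the first tensor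
factor for even `a`, by the corresponding Grassmann generator on the second factor for odd `a`. -/
def mulX : SuperIdx m n → Module.End ℝ (SuperPoly m n)
  | Sum.inl i => TensorProduct.map (LinearMap.mulLeft ℝ (MvPolynomial.X i)) LinearMap.id
  | Sum.inr s => TensorProduct.map LinearMap.id
      (LinearMap.mulLeft ℝ (ExteriorAlgebra.ι ℝ (Pi.single s (1 : ℝ))))

/-- The (left) partial derivative `∂_{X_a}`: the usual partial derivative of polynomials for even `a`,
contraction with the dual basis vector on the Grassmann algebra for odd `a`. -/
def dX : SuperIdx m n → Module.End ℝ (SuperPoly m n)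
  | Sum.inl i => TensorProduct.map (MvPolynomial.pderiv i).toLinearMap LinearMap.id
  | Sum.inr s => TensorProduct.map LinearMap.id
      (CliffordAlgebra.contractLeft (Q := (0 : QuadraticForm ℝ (Fin 2 × Fin n → ℝ)))
        (LinearMap.proj s))

/-- The orthosymplectic metric `g = diag(I_m, J)`, with `J` made of `n` diagonal blocks
`½ (0, -1; 1, 0)`. -/
def metric (m n : ℕ) : Matrix (SuperIdx m n) (SuperIdx m n) ℝ :=
  Matrix.fromBlocks 1 0 0 (Matrix.blockDiagonal fun _ : Fin n => !![0, -1 / 2; 1 / 2, 0])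

/-- The derivative `∂_{X^a}` with respect to the coordinates `X^a = ∑ b, X_b g^{ba}`; as
`X_b = ∑ a, X^a (g⁻¹)_{ab}`, it is `∑ b, (g⁻¹)_{ab} ∂_{X_b}`. -/
def dUpper (a : SuperIdx m n) : Module.End ℝ (SuperPoly m n) :=
  ∑ b, (metric m n)⁻¹ a b • dX b

/-- The operators `L_{ab} = X_a ∂_{X^b} - (-1)^{[a][b]} X_b ∂_{X^a}` spanning `𝔬𝔰𝔭(m|2n)`. -/
def L (a b : SuperIdx m n) : Module.End ℝ (SuperPoly m n) :=
  mulX a * dUpper b - sgn a b • (mulX b * dUpper a)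

variable (m n) in
/-- The Lie superalgebra `𝔬𝔰𝔭(m|2n)` in its realization by differential operators on superpolynomials. -/
def osp : Submodule ℝ (Module.End ℝ (SuperPoly m n)) :=
  Submodule.span ℝ (Set.range fun p : SuperIdx m n × SuperIdx m n => L p.1 p.2)

variable (m n) in
/-- The image of the universal enveloping algebra of `𝔬𝔰𝔭(m|2n)` in the operators on superpolynomials:
the unital `ℝ`-algebra generated by `𝔬𝔰𝔭(m|2n)`, regarded as a subring of the endomorphism ring.
The `𝔬𝔰𝔭(m|2n)`-submodules of the space of superpolynomials, i.e. its linear subspaces stable under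
`𝔬𝔰𝔭(m|2n)`, are the submodules over this ring. -/
def Uosp : Subring (Module.End ℝ (SuperPoly m n)) :=
  (Algebra.adjoin ℝ (osp m n : Set (Module.End ℝ (SuperPoly m n)))).toSubring

variable (m n) in
/-- Multiplication by the square of the radial coordinate `R² = ∑ x_i² - ∑ x̀_{2j-1} x̀_{2j}`. -/
def mulRsq : Module.End ℝ (SuperPoly m n) :=
  ∑ i : Fin m, mulX (Sum.inl i) * mulX (Sum.inl i)
    - ∑ j : Fin n, mulX (Sum.inr (0, j)) * mulX (Sum.inr (1, j))

variable (m n) in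
/-- The super Laplace operator `∇² = ∑ ∂_{x_i}² - 4 ∑ ∂_{x̀_{2j-1}} ∂_{x̀_{2j}}`. -/
def laplacian : Module.End ℝ (SuperPoly m n) :=
  ∑ i : Fin m, dX (Sum.inl i) * dX (Sum.inl i)
    - (4 : ℝ) • ∑ j : Fin n, dX (Sum.inr (0, j)) * dX (Sum.inr (1, j))

variable (m n) in
/-- The super Euler operator `𝔼 = ∑ X_a ∂_{X_a}`. -/
def euler : Module.End ℝ (SuperPoly m n) := ∑ a : SuperIdx m n, mulX a * dX a

variable (m n) in
/-- The parity involution: `x_i ↦ x_i`, `x̀_s ↦ -x̀_s`. -/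
def parity : Module.End ℝ (SuperPoly m n) :=
  TensorProduct.map LinearMap.id (CliffordAlgebra.involute
    (Q := (0 : QuadraticForm ℝ (Fin 2 × Fin n → ℝ)))).toLinearMap

/-! Canonical (anti)commutation relations. -/

theorem sgn_mul_self (a b : SuperIdx m n) : sgn a b * sgn a b = 1 := by
  rcases a with _ | _ <;> rcases b with _ | _ <;> simp [sgn]

theorem end_ext {D D' : Module.End ℝ (SuperPoly m n)}
    (h : ∀ p w, D (tmul p w) = D' (tmul p w)) : D = D' :=
  TensorProduct.ext' h

theorem add_tmul (p q : MvPolynomial (Fin m) ℝ) (w : ExteriorAlgebra ℝ (Fin 2 × Fin n → ℝ)) :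
    tmul (p + q) w = tmul p w + tmul q w :=
  TensorProduct.add_tmul p q w

theorem tmul_add (p : MvPolynomial (Fin m) ℝ) (w v : ExteriorAlgebra ℝ (Fin 2 × Fin n → ℝ)) :
    tmul p (w + v) = tmul p w + tmul p v :=
  TensorProduct.tmul_add p w v

theorem tmul_smul (r : ℝ) (p : MvPolynomial (Fin m) ℝ)
    (w : ExteriorAlgebra ℝ (Fin 2 × Fin n → ℝ)) : tmul p (r • w) = r • tmul p w :=
  TensorProduct.tmul_smul r p w

theorem smul_tmul (r : ℝ) (p : MvPolynomial (Fin m) ℝ)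
    (w : ExteriorAlgebra ℝ (Fin 2 × Fin n → ℝ)) : tmul (r • p) w = r • tmul p w :=
  TensorProduct.smul_tmul' r p w

theorem tmul_neg (p : MvPolynomial (Fin m) ℝ) (w : ExteriorAlgebra ℝ (Fin 2 × Fin n → ℝ)) :
    tmul p (-w) = -tmul p w := by
  simpa using tmul_smul (-1) p w

theorem dX_inl_tmul (i : Fin m) (p : MvPolynomial (Fin m) ℝ)
    (w : ExteriorAlgebra ℝ (Fin 2 × Fin n → ℝ)) :
    dX (Sum.inl i) (tmul p w) = tmul (MvPolynomial.pderiv i p) w := rfl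

theorem dX_inr_tmul (s : Fin 2 × Fin n) (p : MvPolynomial (Fin m) ℝ)
    (w : ExteriorAlgebra ℝ (Fin 2 × Fin n → ℝ)) :
    dX (Sum.inr s) (tmul p w) = tmul p (CliffordAlgebra.contractLeft (LinearMap.proj s) w) := rfl

theorem mulX_inl_tmul (i : Fin m) (p : MvPolynomial (Fin m) ℝ)
    (w : ExteriorAlgebra ℝ (Fin 2 × Fin n → ℝ)) :
    mulX (Sum.inl i) (tmul p w) = tmul (MvPolynomial.X i * p) w := rfl

theorem mulX_inr_tmul (s : Fin 2 × Fin n) (p : MvPolynomial (Fin m) ℝ)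
    (w : ExteriorAlgebra ℝ (Fin 2 × Fin n → ℝ)) :
    mulX (Sum.inr s) (tmul p w) =
      tmul p (ExteriorAlgebra.ι ℝ (Pi.single s (1 : ℝ)) * w) := rfl

theorem mulX_mul_mulX (a b : SuperIdx m n) :
    mulX a * mulX b = sgn a b • (mulX b * mulX a) := by
  refine end_ext fun p w => ?_
  rcases a with a | a <;> rcases b with b | b <;>
    simp only [Module.End.mul_apply, LinearMap.smul_apply, mulX_inl_tmul, mulX_inr_tmul, sgn,
      one_smul]
  · rw [mul_left_comm]
  · have h := eq_neg_of_add_eq_zero_left (ExteriorAlgebra.ι_add_mul_swap (R := ℝ)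
      (Pi.single a (1 : ℝ) : Fin 2 × Fin n → ℝ) (Pi.single b (1 : ℝ)))
    rw [← mul_assoc, ← mul_assoc, h, neg_mul, tmul_neg, neg_smul, one_smul]

theorem dX_mul_dX (a b : SuperIdx m n) : dX a * dX b = sgn a b • (dX b * dX a) := by
  refine end_ext fun p w => ?_
  rcases a with a | a <;> rcases b with b | b <;>
    simp only [Module.End.mul_apply, LinearMap.smul_apply, dX_inl_tmul, dX_inr_tmul, sgn,
      one_smul]
  · have h : ⁅MvPolynomial.pderiv (R := ℝ) a, MvPolynomial.pderiv b⁆ = 0 :=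
      MvPolynomial.derivation_ext fun i => by
        rw [Derivation.commutator_apply, MvPolynomial.pderiv_X, MvPolynomial.pderiv_X]
        simp only [Pi.single_apply, apply_ite, map_zero, Derivation.map_one_eq_zero]
        simp
    have h2 := congrArg (fun D => D p) h
    simp only [Derivation.commutator_apply, Derivation.coe_zero, Pi.zero_apply, sub_eq_zero] at h2
    rw [h2]
  · rw [CliffordAlgebra.contractLeft_comm, tmul_neg, neg_smul, one_smul]

theorem dX_mul_mulX (a b : SuperIdx m n) :
    dX a * mulX b = (if a = b then (1 : ℝ) else 0) • 1 + sgn a b • (mulX b * dX a) := by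
  refine end_ext fun p w => ?_
  rcases a with a | a <;> rcases b with b | b <;>
    simp only [Module.End.mul_apply, LinearMap.smul_apply, LinearMap.add_apply, dX_inl_tmul,
      dX_inr_tmul, mulX_inl_tmul, mulX_inr_tmul, sgn, one_smul, Module.End.one_apply,
      reduceCtorEq, if_false, zero_smul, zero_add, Sum.inl.injEq, Sum.inr.injEq]
  · rw [Derivation.leibniz, MvPolynomial.pderiv_X]
    by_cases h : a = b
    · subst h; simp [add_tmul, add_comm]
    · simp [h, Ne.symm h]
  · have := CliffordAlgebra.contractLeft_ι_mul
      (Q := (0 : QuadraticForm ℝ (Fin 2 × Fin n → ℝ))) (d := LinearMap.proj a)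
      (Pi.single b (1 : ℝ)) w
    rw [ExteriorAlgebra.ι, this]
    rw [sub_eq_add_neg, tmul_add, tmul_neg, neg_smul, one_smul, tmul_smul]
    congr 2
    simp [Pi.single_apply]

theorem metric_inv : (metric m n)⁻¹ =
    Matrix.fromBlocks 1 0 0 (Matrix.blockDiagonal fun _ : Fin n => !![0, 2; -2, 0]) := by
  refine Matrix.inv_eq_right_inv ?_
  have h : (!![0, -1 / 2; 1 / 2, 0] * !![0, 2; -2, 0] : Matrix (Fin 2) (Fin 2) ℝ) = 1 := by
    ext i j; fin_cases i <;> fin_cases j <;> simp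
  rw [metric, Matrix.fromBlocks_multiply, ← Matrix.blockDiagonal_mul]
  simp only [h]
  rw [show (fun _ : Fin n => (1 : Matrix (Fin 2) (Fin 2) ℝ)) = 1 from rfl, Matrix.blockDiagonal_one]
  simp

theorem dUpper_inl (i : Fin m) : dUpper (n := n) (Sum.inl i) = dX (Sum.inl i) := by
  simp [dUpper, metric_inv, Matrix.one_apply]

theorem dUpper_inr_zero (j : Fin n) :
    dUpper (m := m) (Sum.inr (0, j)) = (2 : ℝ) • dX (Sum.inr (1, j)) := by
  simp [dUpper, metric_inv, Matrix.blockDiagonal_apply, Fintype.sum_prod_type]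

theorem dUpper_inr_one (j : Fin n) :
    dUpper (m := m) (Sum.inr (1, j)) = (-2 : ℝ) • dX (Sum.inr (0, j)) := by
  simp [dUpper, metric_inv, Matrix.blockDiagonal_apply, Fintype.sum_prod_type]

theorem sgn_comm (a b : SuperIdx m n) : sgn a b = sgn b a := by
  rcases a with _ | _ <;> rcases b with _ | _ <;> rfl

theorem mulX_comm_pair (a c d : SuperIdx m n) (h : sgn a c = sgn a d) :
    mulX a * (mulX c * mulX d) = mulX c * mulX d * mulX a := by
  rw [← mul_assoc, mulX_mul_mulX a c, smul_mul_assoc, mul_assoc, mulX_mul_mulX a d,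
    mul_smul_comm, smul_smul, h, sgn_mul_self, one_smul, mul_assoc]

theorem dX_comm_pair (a c d : SuperIdx m n) (h : sgn a c = sgn a d) :
    dX a * (dX c * dX d) = dX c * dX d * dX a := by
  rw [← mul_assoc, dX_mul_dX a c, smul_mul_assoc, mul_assoc, dX_mul_dX a d,
    mul_smul_comm, smul_smul, h, sgn_mul_self, one_smul, mul_assoc]

theorem dX_mulX_pair (a c d : SuperIdx m n) (h : sgn a c = sgn a d) :
    dX a * (mulX c * mulX d) = mulX c * mulX d * dX a +
      ((if a = c then (1 : ℝ) else 0) • mulX d +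
        (sgn a c * if a = d then (1 : ℝ) else 0) • mulX c) := by
  rw [← mul_assoc, dX_mul_mulX a c, add_mul, smul_mul_assoc, smul_mul_assoc, one_mul, mul_assoc,
    dX_mul_mulX a d, mul_add, mul_smul_comm, mul_smul_comm, mul_one, smul_add, smul_smul,
    smul_smul, ← h, sgn_mul_self, one_smul, ← mul_assoc]
  abel

theorem dX_pair_mulX (a c d : SuperIdx m n) (h : sgn a c = sgn a d) :
    dX c * dX d * mulX a = mulX a * (dX c * dX d) +
      ((if d = a then (1 : ℝ) else 0) • dX c +
        (sgn a c * if c = a then (1 : ℝ) else 0) • dX d) := by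
  rw [mul_assoc, dX_mul_mulX d a, mul_add, mul_smul_comm, mul_smul_comm, mul_one, ← mul_assoc,
    dX_mul_mulX c a, add_mul, smul_mul_assoc, smul_mul_assoc, one_mul, smul_add, smul_smul,
    smul_smul, sgn_comm d a, sgn_comm c a, ← h, sgn_mul_self, one_smul, mul_assoc]
  abel

theorem mulX_mul_Rsq (a : SuperIdx m n) :
    mulX a * mulRsq m n = mulRsq m n * mulX a := by
  rw [mulRsq, mul_sub, sub_mul, Finset.mul_sum, Finset.mul_sum, Finset.sum_mul,
    Finset.sum_mul]
  congr 1
  · exact Finset.sum_congr rfl fun i _ => mulX_comm_pair _ _ _ rfl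
  · exact Finset.sum_congr rfl fun i _ => mulX_comm_pair _ _ _ (by cases a <;> rfl)

theorem dX_mul_laplacian (a : SuperIdx m n) :
    dX a * laplacian m n = laplacian m n * dX a := by
  rw [laplacian, mul_sub, sub_mul, mul_smul_comm, smul_mul_assoc, Finset.mul_sum, Finset.mul_sum,
    Finset.sum_mul, Finset.sum_mul]
  congr 1
  · exact Finset.sum_congr rfl fun i _ => dX_comm_pair _ _ _ rfl
  · congr 1
    exact Finset.sum_congr rfl fun i _ => dX_comm_pair _ _ _ (by cases a <;> rfl)

theorem dX_mul_Rsq (a : SuperIdx m n) :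
    dX a * mulRsq m n = mulRsq m n * dX a +
      (∑ i : Fin m, ((if a = Sum.inl i then (1 : ℝ) else 0) • mulX (Sum.inl i) +
          (if a = Sum.inl i then (1 : ℝ) else 0) • mulX (Sum.inl i)) -
        ∑ j : Fin n, ((if a = Sum.inr (0, j) then (1 : ℝ) else 0) • mulX (Sum.inr (1, j)) -
          (if a = Sum.inr (1, j) then (1 : ℝ) else 0) • mulX (Sum.inr (0, j)))) := by
  rw [mulRsq, mul_sub, sub_mul, Finset.mul_sum, Finset.mul_sum, Finset.sum_mul,
    Finset.sum_mul, sub_add_sub_comm, ← Finset.sum_add_distrib, ← Finset.sum_add_distrib]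
  congr 1
  · refine Finset.sum_congr rfl fun i _ => ?_
    rw [dX_mulX_pair _ _ _ rfl]
    cases a <;> simp [sgn]
  · refine Finset.sum_congr rfl fun i _ => ?_
    rw [dX_mulX_pair _ _ _ (by cases a <;> rfl)]
    cases a <;> simp only [sgn, neg_one_mul, neg_smul, sub_eq_add_neg, reduceCtorEq,
      if_false, zero_smul, neg_zero, mul_zero]

theorem laplacian_mul_mulX_aux (a : SuperIdx m n) :
    laplacian m n * mulX a = mulX a * laplacian m n +
      (∑ i : Fin m, ((if Sum.inl i = a then (1 : ℝ) else 0) • dX (Sum.inl i) +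
          (if Sum.inl i = a then (1 : ℝ) else 0) • dX (Sum.inl i)) -
        (4 : ℝ) • ∑ j : Fin n,
          ((if Sum.inr (1, j) = a then (1 : ℝ) else 0) • dX (Sum.inr (0, j)) -
          (if Sum.inr (0, j) = a then (1 : ℝ) else 0) • dX (Sum.inr (1, j)))) := by
  rw [laplacian, mul_sub, sub_mul, mul_smul_comm, smul_mul_assoc, Finset.mul_sum, Finset.mul_sum,
    Finset.sum_mul, Finset.sum_mul, sub_add_sub_comm, ← Finset.sum_add_distrib, ← smul_add,
    ← Finset.sum_add_distrib]
  congr 1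
  · refine Finset.sum_congr rfl fun i _ => ?_
    rw [dX_pair_mulX _ _ _ rfl]
    cases a <;> simp [sgn]
  · congr 1
    refine Finset.sum_congr rfl fun i _ => ?_
    rw [dX_pair_mulX _ _ _ (by cases a <;> rfl)]
    cases a <;> simp only [sgn, neg_one_mul, neg_smul, sub_eq_add_neg, reduceCtorEq,
      if_false, zero_smul, neg_zero, mul_zero]

theorem dUpper_mul_Rsq (a : SuperIdx m n) :
    dUpper a * mulRsq m n =
      mulRsq m n * dUpper a + (2 : ℝ) • mulX a := by
  rcases a with i | ⟨s, j⟩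
  · rw [dUpper_inl, dX_mul_Rsq]
    simp [two_smul, Finset.sum_add_distrib]
  · fin_cases s
    · simp only [Fin.zero_eta]
      rw [dUpper_inr_zero, smul_mul_assoc, dX_mul_Rsq]
      simp
    · simp only [Fin.mk_one]
      rw [dUpper_inr_one, smul_mul_assoc, dX_mul_Rsq]
      simp [smul_add]

theorem laplacian_mul_mulX (a : SuperIdx m n) :
    laplacian m n * mulX a = mulX a * laplacian m n + (2 : ℝ) • dUpper a := by
  rw [laplacian_mul_mulX_aux]
  congr 1
  rcases a with i | ⟨s, j⟩
  · simp [dUpper_inl, two_smul, Finset.sum_add_distrib]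
  · fin_cases s
    · simp only [Fin.zero_eta]
      rw [dUpper_inr_zero, smul_smul]
      simp
      try norm_num
    · simp only [Fin.mk_one]
      rw [dUpper_inr_one, smul_smul]
      simp
      try norm_num

theorem dUpper_mul_laplacian (a : SuperIdx m n) :
    dUpper a * laplacian m n = laplacian m n * dUpper a := by
  simp only [dUpper, Finset.sum_mul, Finset.mul_sum, smul_mul_assoc, mul_smul_comm,
    dX_mul_laplacian]

theorem dX_mul_euler (a : SuperIdx m n) : dX a * euler m n = euler m n * dX a + dX a := by
  have h : ∀ c : SuperIdx m n, dX a * (mulX c * dX c) =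
      mulX c * dX c * dX a + (if a = c then (1 : ℝ) else 0) • dX c := fun c => by
    rw [← mul_assoc, dX_mul_mulX, add_mul, smul_mul_assoc, smul_mul_assoc, one_mul, mul_assoc,
      dX_mul_dX a c, mul_smul_comm, smul_smul, sgn_mul_self, one_smul, mul_assoc, add_comm]
  rw [euler, Finset.mul_sum, Finset.sum_mul, Finset.sum_congr rfl fun c _ => h c,
    Finset.sum_add_distrib]
  simp

theorem euler_mul_mulX (a : SuperIdx m n) :
    euler m n * mulX a = mulX a * euler m n + mulX a := by
  have h : ∀ c : SuperIdx m n, mulX c * dX c * mulX a =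
      mulX a * (mulX c * dX c) + (if c = a then (1 : ℝ) else 0) • mulX c := fun c => by
    rw [mul_assoc, dX_mul_mulX, mul_add, mul_smul_comm, mul_smul_comm, mul_one, ← mul_assoc,
      mulX_mul_mulX c a, smul_mul_assoc, smul_smul, sgn_mul_self, one_smul, mul_assoc, add_comm]
  rw [euler, Finset.mul_sum, Finset.sum_mul, Finset.sum_congr rfl fun c _ => h c,
    Finset.sum_add_distrib]
  simp

theorem dUpper_mul_euler (a : SuperIdx m n) :
    dUpper a * euler m n = euler m n * dUpper a + dUpper a := by
  simp only [dUpper, Finset.sum_mul, Finset.mul_sum, smul_mul_assoc, mul_smul_comm,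
    dX_mul_euler, smul_add, Finset.sum_add_distrib]

theorem dUpper_mul_dUpper (a b : SuperIdx m n) :
    dUpper a * dUpper b = sgn a b • (dUpper b * dUpper a) := by
  rcases a with a | ⟨s, a⟩ <;> rcases b with b | ⟨t, b⟩ <;> (try fin_cases s) <;>
    (try fin_cases t) <;>
    simp only [Fin.zero_eta, Fin.mk_one, dUpper_inl, dUpper_inr_zero, dUpper_inr_one,
      smul_mul_assoc, mul_smul_comm] <;>
    rw [dX_mul_dX] <;> simp [sgn]

/-! The generators of `𝔬𝔰𝔭(m|2n)` commute with `R²`, `∇²` and `𝔼`. -/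

theorem commute_Rsq_L (a b : SuperIdx m n) : Commute (mulRsq m n) (L a b) := by
  have h : ∀ a b : SuperIdx m n, mulX a * dUpper b * mulRsq m n =
      mulRsq m n * (mulX a * dUpper b) + (2 : ℝ) • (mulX a * mulX b) :=
    fun a b => by
      rw [mul_assoc, dUpper_mul_Rsq, mul_add, ← mul_assoc, mulX_mul_Rsq, mul_assoc, mul_smul_comm]
  rw [commute_iff_eq, L, mul_sub, sub_mul, h, smul_mul_assoc, h, mulX_mul_mulX a b, smul_add,
    mul_smul_comm, smul_comm (sgn a b) (2 : ℝ)]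
  abel

theorem commute_laplacian_L (a b : SuperIdx m n) : Commute (laplacian m n) (L a b) := by
  have h : ∀ a b : SuperIdx m n, laplacian m n * (mulX a * dUpper b) =
      mulX a * dUpper b * laplacian m n + (2 : ℝ) • (dUpper a * dUpper b) := fun a b => by
    rw [← mul_assoc, laplacian_mul_mulX, add_mul, mul_assoc, ← dUpper_mul_laplacian,
      smul_mul_assoc, mul_assoc]
  rw [commute_iff_eq, L, mul_sub, sub_mul, h, mul_smul_comm, smul_mul_assoc, h,
    dUpper_mul_dUpper a b, smul_add, smul_comm (sgn a b) (2 : ℝ)]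
  abel

theorem commute_euler_L (a b : SuperIdx m n) : Commute (euler m n) (L a b) := by
  have h : ∀ a b : SuperIdx m n, euler m n * (mulX a * dUpper b) =
      mulX a * dUpper b * euler m n := fun a b => by
    rw [← mul_assoc, euler_mul_mulX, add_mul, mul_assoc, mul_assoc, dUpper_mul_euler, mul_add]
  rw [commute_iff_eq, L, mul_sub, sub_mul, h, mul_smul_comm, smul_mul_assoc, h]

/-- An operator commuting with all `L_{ab}` is a homomorphism of `𝔬𝔰𝔭(m|2n)`-modules. -/
def toOspHom (D : Module.End ℝ (SuperPoly m n)) (hD : ∀ a b, Commute D (L a b)) :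
    SuperPoly m n →ₗ[Uosp m n] SuperPoly m n where
  toFun := D
  map_add' := map_add D
  map_smul' u f := by
    have h : Algebra.adjoin ℝ (osp m n : Set (Module.End ℝ (SuperPoly m n))) ≤
        Subalgebra.centralizer ℝ {D} := by
      refine Algebra.adjoin_le ?_
      rw [← Subalgebra.coe_toSubmodule, SetLike.coe_subset_coe, osp, Submodule.span_le]
      rintro _ ⟨p, rfl⟩
      exact (Subalgebra.mem_centralizer_iff ℝ).2 fun g hg => by
        rw [Set.mem_singleton_iff.1 hg]; exact (hD p.1 p.2).eq
    have h2 := (Subalgebra.mem_centralizer_iff ℝ).1 (h u.2) D rfl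
    exact LinearMap.congr_fun h2 f

variable (m n) in
/-- Multiplication by `R²` as a homomorphism of `𝔬𝔰𝔭(m|2n)`-modules. -/
def RsqHom : SuperPoly m n →ₗ[Uosp m n] SuperPoly m n :=
  toOspHom (mulRsq m n) commute_Rsq_L

variable (m n) in
/-- The super Laplace operator as a homomorphism of `𝔬𝔰𝔭(m|2n)`-modules. -/
def laplacianHom : SuperPoly m n →ₗ[Uosp m n] SuperPoly m n :=
  toOspHom (laplacian m n) commute_laplacian_L

variable (m n) in
/-- The super Euler operator as a homomorphism of `𝔬𝔰𝔭(m|2n)`-modules. -/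
def eulerHom : SuperPoly m n →ₗ[Uosp m n] SuperPoly m n :=
  toOspHom (euler m n) commute_euler_L

variable (m n) in
/-- The `𝔬𝔰𝔭(m|2n)`-module `𝒫_k = {f | 𝔼 f = k f}` of superpolynomials of degree `k`
(zero for negative `k`). -/
def polyDeg (k : ℤ) : Submodule (Uosp m n) (SuperPoly m n) :=
  LinearMap.eqLocus (eulerHom m n) (k • LinearMap.id)

variable (m n) in
/-- The `𝔬𝔰𝔭(m|2n)`-module `ℋ_k = 𝒫_k ∩ ker ∇²` of spherical harmonics of degree `k`. -/
def harmonic (k : ℤ) : Submodule (Uosp m n) (SuperPoly m n) :=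
  polyDeg m n k ⊓ LinearMap.ker (laplacianHom m n)

variable (m n) in
/-- The `𝔬𝔰𝔭(m|2n)`-submodule `R²𝒫_{k-2} ∩ ℋ_k` of `ℋ_k`. -/
def radialHarmonic (k : ℤ) : Submodule (Uosp m n) (SuperPoly m n) :=
  (polyDeg m n (k - 2)).map (RsqHom m n) ⊓ harmonic m n k

end

end SuperPoly

namespace SuperPoly
noncomputable section
variable {m n : ℕ}

/-! ### Elementwise commutation relations -/

theorem mulX_inl_comm (i : Fin m) (a : SuperIdx m n) (f : SuperPoly m n) :
    mulX a (mulX (Sum.inl i) f) = mulX (Sum.inl i) (mulX a f) := by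
  have := LinearMap.congr_fun (mulX_mul_mulX a (Sum.inl i)) f
  rcases a with a | a <;> simpa [sgn] using this

theorem dX_inl_comm (i : Fin m) (a : SuperIdx m n) (f : SuperPoly m n) :
    dX a (dX (Sum.inl i) f) = dX (Sum.inl i) (dX a f) := by
  have := LinearMap.congr_fun (dX_mul_dX a (Sum.inl i)) f
  rcases a with a | a <;> simpa [sgn] using this

theorem dX_mulX_self (i : Fin m) (f : SuperPoly m n) :
    dX (Sum.inl i) (mulX (Sum.inl i) f) = f + mulX (Sum.inl i) (dX (Sum.inl i) f) := by
  simpa [sgn] using LinearMap.congr_fun (dX_mul_mulX (Sum.inl i) (Sum.inl i)) f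

theorem dX_mulX_inl_of_ne {i : Fin m} {a : SuperIdx m n} (h : a ≠ Sum.inl i)
    (f : SuperPoly m n) : dX a (mulX (Sum.inl i) f) = mulX (Sum.inl i) (dX a f) := by
  have := LinearMap.congr_fun (dX_mul_mulX a (Sum.inl i)) f
  rcases a with a | a <;> simpa [sgn, h] using this

theorem dX_inl_mulX_of_ne {i : Fin m} {a : SuperIdx m n} (h : a ≠ Sum.inl i)
    (f : SuperPoly m n) : dX (Sum.inl i) (mulX a f) = mulX a (dX (Sum.inl i) f) := by
  have := LinearMap.congr_fun (dX_mul_mulX (Sum.inl i) a) f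
  rcases a with a | a <;> simpa [sgn, h.symm] using this

theorem dX_inl_mulX_inl_of_ne {i j : Fin m} (h : j ≠ i) (f : SuperPoly m n) :
    dX (Sum.inl i) (mulX (Sum.inl j) f) = mulX (Sum.inl j) (dX (Sum.inl i) f) :=
  dX_inl_mulX_of_ne (by simpa using h) f

theorem dX_inl_Rsq (i : Fin m) (f : SuperPoly m n) :
    dX (Sum.inl i) (mulRsq m n f) =
      mulRsq m n (dX (Sum.inl i) f) + (2 : ℝ) • mulX (Sum.inl i) f := by
  simpa [dUpper_inl] using LinearMap.congr_fun (dUpper_mul_Rsq (n := n) (Sum.inl i)) f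

theorem mulX_Rsq (a : SuperIdx m n) (f : SuperPoly m n) :
    mulX a (mulRsq m n f) = mulRsq m n (mulX a f) :=
  LinearMap.congr_fun (mulX_mul_Rsq a) f

theorem dX_laplacian (a : SuperIdx m n) (f : SuperPoly m n) :
    dX a (laplacian m n f) = laplacian m n (dX a f) :=
  LinearMap.congr_fun (dX_mul_laplacian a) f

theorem laplacian_mulX_inl (i : Fin m) (f : SuperPoly m n) :
    laplacian m n (mulX (Sum.inl i) f) =
      mulX (Sum.inl i) (laplacian m n f) + (2 : ℝ) • dX (Sum.inl i) f := by
  simpa [dUpper_inl] using LinearMap.congr_fun (laplacian_mul_mulX (n := n) (Sum.inl i)) f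

theorem euler_mulX (a : SuperIdx m n) (f : SuperPoly m n) :
    euler m n (mulX a f) = mulX a (euler m n f) + mulX a f :=
  LinearMap.congr_fun (euler_mul_mulX a) f

theorem euler_dX (a : SuperIdx m n) (f : SuperPoly m n) :
    euler m n (dX a f) = dX a (euler m n f) - dX a f :=
  eq_sub_of_add_eq (LinearMap.congr_fun (dX_mul_euler a) f).symm

theorem euler_Rsq (f : SuperPoly m n) :
    euler m n (mulRsq m n f) = mulRsq m n (euler m n f) + (2 : ℝ) • mulRsq m n f := by
  have h : ∀ a b : SuperIdx m n, euler m n (mulX a (mulX b f)) =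
      mulX a (mulX b (euler m n f)) + (2 : ℝ) • mulX a (mulX b f) := fun a b => by
    rw [euler_mulX, euler_mulX, map_add]; module
  simp only [mulRsq, LinearMap.sub_apply, LinearMap.sum_apply, Module.End.mul_apply, map_sub,
    map_sum, h, Finset.sum_add_distrib, smul_sub, Finset.smul_sum]
  abel

theorem euler_laplacian (f : SuperPoly m n) :
    euler m n (laplacian m n f) = laplacian m n (euler m n f) - (2 : ℝ) • laplacian m n f := by
  have h : ∀ a b : SuperIdx m n, euler m n (dX a (dX b f)) =
      dX a (dX b (euler m n f)) - (2 : ℝ) • dX a (dX b f) := fun a b => by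
    rw [euler_dX, euler_dX, map_sub]; module
  simp only [laplacian, LinearMap.sub_apply, LinearMap.sum_apply, Module.End.mul_apply, map_sub,
    map_sum, h, Finset.sum_sub_distrib, smul_sub, Finset.smul_sum, LinearMap.smul_apply, map_smul]
  simp only [smul_comm (2 : ℝ) (4 : ℝ)]
  abel

theorem laplacian_Rsq (f : SuperPoly m n) :
    laplacian m n (mulRsq m n f) = mulRsq m n (laplacian m n f) + (4 : ℝ) • euler m n f +
      (2 * superDim m n : ℝ) • f := by
  have hb : ∀ i : Fin m, laplacian m n (mulX (Sum.inl i) (mulX (Sum.inl i) f)) =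
      mulX (Sum.inl i) (mulX (Sum.inl i) (laplacian m n f)) +
        ((4 : ℝ) • mulX (Sum.inl i) (dX (Sum.inl i) f) + (2 : ℝ) • f) := fun i => by
    rw [laplacian_mulX_inl, laplacian_mulX_inl, dX_mulX_self]
    simp only [map_add, map_smul]
    module
  have hl0 : ∀ (j : Fin n) (g : SuperPoly m n), laplacian m n (mulX (Sum.inr (0, j)) g) =
      mulX (Sum.inr (0, j)) (laplacian m n g) + (4 : ℝ) • dX (Sum.inr (1, j)) g := fun j g => by
    have := LinearMap.congr_fun (laplacian_mul_mulX (m := m) (Sum.inr (0, j))) g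
    simp only [dUpper_inr_zero, Module.End.mul_apply, LinearMap.add_apply,
      LinearMap.smul_apply] at this
    rw [this]; module
  have hl1 : ∀ (j : Fin n) (g : SuperPoly m n), laplacian m n (mulX (Sum.inr (1, j)) g) =
      mulX (Sum.inr (1, j)) (laplacian m n g) - (4 : ℝ) • dX (Sum.inr (0, j)) g := fun j g => by
    have := LinearMap.congr_fun (laplacian_mul_mulX (m := m) (Sum.inr (1, j))) g
    simp only [dUpper_inr_one, Module.End.mul_apply, LinearMap.add_apply,
      LinearMap.smul_apply] at this
    rw [this]; module
  have hd : ∀ j : Fin n, dX (Sum.inr (1, j)) (mulX (Sum.inr (1, j)) f) =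
      f - mulX (Sum.inr (1, j)) (dX (Sum.inr (1, j)) f) := fun j => by
    simpa [sgn, sub_eq_add_neg] using
      LinearMap.congr_fun (dX_mul_mulX (m := m) (Sum.inr (1, j)) (Sum.inr (1, j))) f
  have hf : ∀ j : Fin n, laplacian m n (mulX (Sum.inr (0, j)) (mulX (Sum.inr (1, j)) f)) =
      mulX (Sum.inr (0, j)) (mulX (Sum.inr (1, j)) (laplacian m n f)) -
        ((4 : ℝ) • mulX (Sum.inr (0, j)) (dX (Sum.inr (0, j)) f) +
          (4 : ℝ) • mulX (Sum.inr (1, j)) (dX (Sum.inr (1, j)) f) - (4 : ℝ) • f) := fun j => by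
    rw [hl0, hl1, hd]
    simp only [map_sub, map_smul]
    module
  simp only [mulRsq, euler, LinearMap.sub_apply, LinearMap.sum_apply, Module.End.mul_apply,
    map_sub, map_sum, hb, hf, Finset.sum_add_distrib, Finset.sum_sub_distrib, ← Finset.smul_sum,
    Fintype.sum_sum_type, Fintype.sum_prod_type, Fin.sum_univ_two, Finset.sum_const,
    Finset.card_univ, Fintype.card_fin, superDim]
  simp only [LinearMap.add_apply, LinearMap.sum_apply, Module.End.mul_apply]
  push_cast
  module

/-! ### The space of superpolynomials is generated by the coordinates -/

theorem eq_top_of_mulX_mem (S : Submodule ℝ (SuperPoly m n)) (h1 : tmul 1 1 ∈ S)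
    (hX : ∀ a, ∀ f ∈ S, mulX a f ∈ S) : S = ⊤ := by
  have hw : ∀ w : ExteriorAlgebra ℝ (Fin 2 × Fin n → ℝ), tmul (1 : MvPolynomial (Fin m) ℝ) w ∈ S := by
    intro w
    induction w using CliffordAlgebra.left_induction with
    | algebraMap r =>
      rw [Algebra.algebraMap_eq_smul_one, tmul_smul]
      exact S.smul_mem _ h1
    | add x y hx hy => rw [tmul_add]; exact S.add_mem hx hy
    | ι_mul x v hx =>
      have hv : v = ∑ s, v s • (Pi.single s (1 : ℝ) : Fin 2 × Fin n → ℝ) := by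
        ext s; simp [Finset.sum_apply, Pi.single_apply]
      have : tmul (1 : MvPolynomial (Fin m) ℝ)
          ((CliffordAlgebra.ι (0 : QuadraticForm ℝ (Fin 2 × Fin n → ℝ)) v) * x) =
          ∑ s, v s • mulX (Sum.inr s) (tmul 1 x) := by
        conv_lhs => rw [hv]
        simp only [map_sum, Finset.sum_mul, map_smul, smul_mul_assoc, mulX_inr_tmul]
        simp only [← tmul_smul]
        exact TensorProduct.tmul_sum _ _ _
      rw [this]
      exact S.sum_mem fun s _ => S.smul_mem _ (hX _ _ hx)
  have hp : ∀ (p : MvPolynomial (Fin m) ℝ) (w : ExteriorAlgebra ℝ (Fin 2 × Fin n → ℝ)),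
      tmul p w ∈ S := by
    intro p w
    induction p using MvPolynomial.induction_on with
    | C r =>
      rw [← mul_one (MvPolynomial.C r), ← MvPolynomial.smul_eq_C_mul, smul_tmul]
      exact S.smul_mem _ (hw w)
    | add p q hp hq => rw [add_tmul]; exact S.add_mem hp hq
    | mul_X p i hp => rw [mul_comm, ← mulX_inl_tmul]; exact hX _ _ hp
  refine eq_top_iff.2 fun f _ => ?_
  exact TensorProduct.induction_on f S.zero_mem hp fun x y hx hy => S.add_mem hx hy

/-! ### Injectivity of the multiplication by `R²` -/

theorem mulLeft_inl_injective {q : MvPolynomial (Fin m) ℝ} (hq : q ≠ 0) :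
    Function.Injective (TensorProduct.map (LinearMap.mulLeft ℝ q) LinearMap.id :
      Module.End ℝ (SuperPoly m n)) :=
  Module.Flat.rTensor_preserves_injective_linearMap (M := ExteriorAlgebra ℝ (Fin 2 × Fin n → ℝ))
    (LinearMap.mulLeft ℝ q) (mul_right_injective₀ hq)

theorem sum_mulX_inl_sq (s : Finset (Fin m)) :
    (∑ i ∈ s, mulX (Sum.inl i) * mulX (Sum.inl i) : Module.End ℝ (SuperPoly m n)) =
      TensorProduct.map (LinearMap.mulLeft ℝ (∑ i ∈ s, MvPolynomial.X i ^ 2)) LinearMap.id := by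
  refine end_ext fun p w => ?_
  simp only [LinearMap.sum_apply, Module.End.mul_apply, mulX_inl_tmul]
  simp only [← mul_assoc, ← pow_two]
  refine (TensorProduct.sum_tmul _ _ _).symm.trans ?_
  rw [← Finset.sum_mul]
  rfl

theorem sum_X_sq_ne_zero {s : Finset (Fin m)} (hs : s.Nonempty) :
    (∑ i ∈ s, MvPolynomial.X i ^ 2 : MvPolynomial (Fin m) ℝ) ≠ 0 := by
  intro h
  have := congrArg (MvPolynomial.eval fun _ => (1 : ℝ)) h
  simp [hs.ne_empty] at this

theorem sum_mulX_inl_sq_injective {s : Finset (Fin m)} (hs : s.Nonempty) :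
    Function.Injective
      (∑ i ∈ s, mulX (Sum.inl i) * mulX (Sum.inl i) : Module.End ℝ (SuperPoly m n)) := by
  rw [sum_mulX_inl_sq]
  exact mulLeft_inl_injective (sum_X_sq_ne_zero hs)

theorem mulX_pair_commute {a b c d : SuperIdx m n} (ha : sgn a c = sgn a d)
    (hb : sgn b c = sgn b d) : Commute (mulX a * mulX b) (mulX c * mulX d) := by
  rw [commute_iff_eq, mul_assoc, mulX_comm_pair b c d hb, ← mul_assoc, mulX_comm_pair a c d ha,
    mul_assoc]

theorem isNilpotent_sum_mulX_inr :
    IsNilpotent (∑ j : Fin n, mulX (Sum.inr (0, j)) * mulX (Sum.inr (1, j)) :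
      Module.End ℝ (SuperPoly m n)) := by
  have hc : ∀ j j' : Fin n, Commute
      (mulX (Sum.inr (0, j)) * mulX (Sum.inr (1, j)) : Module.End ℝ (SuperPoly m n))
      (mulX (Sum.inr (0, j')) * mulX (Sum.inr (1, j'))) := fun j j' => by
    exact mulX_pair_commute rfl rfl
  refine Commute.isNilpotent_sum (fun j _ => ?_) fun j j' _ _ => hc j j'
  have h0 : (mulX (Sum.inr (0, j)) * mulX (Sum.inr (0, j)) : Module.End ℝ (SuperPoly m n)) = 0 := by
    have := mulX_mul_mulX (m := m) (n := n) (Sum.inr (0, j)) (Sum.inr (0, j))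
    rw [sgn, neg_smul, one_smul] at this
    have h2 : (2 : ℝ) • (mulX (Sum.inr (0, j)) * mulX (Sum.inr (0, j)) :
        Module.End ℝ (SuperPoly m n)) = 0 := by
      rw [two_smul]
      exact eq_neg_iff_add_eq_zero.1 this
    exact (smul_eq_zero.1 h2).resolve_left two_ne_zero
  refine ⟨2, ?_⟩
  rw [pow_two, mul_assoc, mulX_comm_pair (Sum.inr (1, j)) (Sum.inr (0, j)) (Sum.inr (1, j)) rfl,
    ← mul_assoc, ← mul_assoc, h0, zero_mul, zero_mul]

theorem mulRsq_injective (hm : m ≠ 0) : Function.Injective (mulRsq m n) := by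
  have : NeZero m := ⟨hm⟩
  set A : Module.End ℝ (SuperPoly m n) := ∑ i : Fin m, mulX (Sum.inl i) * mulX (Sum.inl i) with hA
  set B : Module.End ℝ (SuperPoly m n) := ∑ j : Fin n, mulX (Sum.inr (0, j)) * mulX (Sum.inr (1, j))
    with hB
  have hAinj : Function.Injective A := sum_mulX_inl_sq_injective ⟨0, Finset.mem_univ _⟩
  have hcomm : Commute A B := by
    refine Commute.sum_left _ _ _ fun i _ => Commute.sum_right _ _ _ fun j _ => ?_
    exact mulX_pair_commute rfl rfl
  obtain ⟨N, hN⟩ : IsNilpotent B := isNilpotent_sum_mulX_inr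
  have hdvd : ∃ C, A ^ N = C * (A - B) := by
    have h := hcomm.symm.mul_geom_sum₂ N
    refine ⟨∑ i ∈ Finset.range N, A ^ i * B ^ (N - 1 - i), ?_⟩
    rw [hcomm.geom_sum₂_mul, hN, sub_zero]
  obtain ⟨C, hC⟩ := hdvd
  have hAN : Function.Injective (A ^ N) := by
    rw [Module.End.coe_pow]; exact hAinj.iterate N
  rw [hC, Module.End.mul_eq_comp, LinearMap.coe_comp] at hAN
  exact hAN.of_comp

end
end SuperPoly

noncomputable section EigenBelow
open Polynomial

namespace Module.End

variable {V : Type*} [AddCommGroup V] [Module ℝ V]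

/-- The sum of the eigenspaces of `A` for the eigenvalues `c t` with `t < N`. -/
def eigenBelow (A : Module.End ℝ V) (c : ℕ → ℝ) (N : ℕ) : Submodule ℝ V :=
  ⨆ t ∈ Finset.range N, A.eigenspace (c t)

variable {A : Module.End ℝ V} {c : ℕ → ℝ} {N : ℕ} {f : V}

theorem mem_eigenBelow {t : ℕ} (ht : t < N) (hf : A f = c t • f) : f ∈ A.eigenBelow c N :=
  le_iSup₂_of_le (f := fun t (_ : t ∈ Finset.range N) => A.eigenspace (c t)) t
    (Finset.mem_range.2 ht) le_rfl (mem_eigenspace_iff.2 hf)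

theorem eigenBelow_le {S : Submodule ℝ V} (h : ∀ t < N, ∀ f, A f = c t • f → f ∈ S) :
    A.eigenBelow c N ≤ S :=
  iSup₂_le fun t ht f hf => h t (Finset.mem_range.1 ht) f (mem_eigenspace_iff.1 hf)

theorem eigenBelow_mono {N' : ℕ} (h : N ≤ N') : A.eigenBelow c N ≤ A.eigenBelow c N' :=
  eigenBelow_le fun _ ht _ hf => mem_eigenBelow (ht.trans_le h) hf

theorem eigenBelow_zero : A.eigenBelow c 0 = ⊥ := by simp [eigenBelow]

theorem exists_of_mem_eigenBelow_succ (hf : f ∈ A.eigenBelow c (N + 1)) :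
    ∃ g, A g = c N • g ∧ ∃ d ∈ A.eigenBelow c N, f = g + d := by
  rw [eigenBelow, Finset.range_add_one, Finset.iSup_insert] at hf
  obtain ⟨g, hg, d, hd, rfl⟩ := Submodule.mem_sup.1 hf
  exact ⟨g, mem_eigenspace_iff.1 hg, d, hd, rfl⟩

theorem aeval_apply_of_apply_eq_smul {μ : ℝ} (hf : A f = μ • f) (P : ℝ[X]) :
    aeval A P f = P.eval μ • f := by
  by_cases h : f = 0
  · simp [h]
  · exact aeval_apply_of_hasEigenvector ⟨mem_eigenspace_iff.2 hf, h⟩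

theorem aeval_prod_apply_of_mem_eigenBelow (hf : f ∈ A.eigenBelow c N) :
    aeval A (∏ t ∈ Finset.range N, (X - C (c t))) f = 0 := by
  refine LinearMap.mem_ker.1 (eigenBelow_le (fun t ht g hg => ?_) hf)
  rw [LinearMap.mem_ker, aeval_apply_of_apply_eq_smul hg, eval_prod,
    Finset.prod_eq_zero (Finset.mem_range.2 ht) (by simp), zero_smul]

theorem eval_prod_ne_zero {μ : ℝ} (h : ∀ t < N, c t ≠ μ) :
    (∏ t ∈ Finset.range N, (X - C (c t)) : ℝ[X]).eval μ ≠ 0 := by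
  rw [eval_prod]
  refine Finset.prod_ne_zero_iff.2 fun t ht => ?_
  simpa using sub_ne_zero.2 (h t (Finset.mem_range.1 ht)).symm

theorem eq_zero_of_mem_eigenBelow {μ : ℝ} (hf : A f = μ • f) (hf' : f ∈ A.eigenBelow c N)
    (h : ∀ t < N, c t ≠ μ) : f = 0 := by
  have := aeval_prod_apply_of_mem_eigenBelow hf'
  rw [aeval_apply_of_apply_eq_smul hf] at this
  exact (smul_eq_zero.1 this).resolve_left (eval_prod_ne_zero h)

theorem exists_mem_eigenBelow (h : f ∈ ⨆ t : ℕ, A.eigenspace (c t)) :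
    ∃ N, f ∈ A.eigenBelow c N := by
  induction h using Submodule.iSup_induction' with
  | mem t x hx => exact ⟨t + 1, mem_eigenBelow t.lt_succ_self (mem_eigenspace_iff.1 hx)⟩
  | zero => exact ⟨0, zero_mem _⟩
  | add x y _ _ hx hy =>
    obtain ⟨N, hN⟩ := hx
    obtain ⟨N', hN'⟩ := hy
    exact ⟨max N N', add_mem (eigenBelow_mono (le_max_left _ _) hN)
      (eigenBelow_mono (le_max_right _ _) hN')⟩

end Module.End

end EigenBelow

namespace SuperPoly
noncomputable section
variable {m n : ℕ}

/-! ### The plane spanned by two bosonic coordinates -/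

/-- The Euler operator `x_i ∂_i + x_j ∂_j` of the plane. -/
def planeEuler (i j : Fin m) : Module.End ℝ (SuperPoly m n) :=
  mulX (Sum.inl i) * dX (Sum.inl i) + mulX (Sum.inl j) * dX (Sum.inl j)

/-- Multiplication by `x_i² + x_j²`. -/
def planeRsq (i j : Fin m) : Module.End ℝ (SuperPoly m n) :=
  mulX (Sum.inl i) * mulX (Sum.inl i) + mulX (Sum.inl j) * mulX (Sum.inl j)

/-- The Laplace operator `∂_i² + ∂_j²` of the plane. -/
def planeLap (i j : Fin m) : Module.End ℝ (SuperPoly m n) :=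
  dX (Sum.inl i) * dX (Sum.inl i) + dX (Sum.inl j) * dX (Sum.inl j)

/-- The infinitesimal rotation `x_i ∂_j - x_j ∂_i` of the plane. -/
def rotation (i j : Fin m) : Module.End ℝ (SuperPoly m n) := L (Sum.inl i) (Sum.inl j)

theorem planeEuler_apply (i j : Fin m) (f : SuperPoly m n) : planeEuler i j f =
    mulX (Sum.inl i) (dX (Sum.inl i) f) + mulX (Sum.inl j) (dX (Sum.inl j) f) := rfl

theorem planeRsq_apply (i j : Fin m) (f : SuperPoly m n) : planeRsq i j f =
    mulX (Sum.inl i) (mulX (Sum.inl i) f) + mulX (Sum.inl j) (mulX (Sum.inl j) f) := rfl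

theorem planeLap_apply (i j : Fin m) (f : SuperPoly m n) : planeLap i j f =
    dX (Sum.inl i) (dX (Sum.inl i) f) + dX (Sum.inl j) (dX (Sum.inl j) f) := rfl

theorem rotation_apply (i j : Fin m) (f : SuperPoly m n) : rotation i j f =
    mulX (Sum.inl i) (dX (Sum.inl j) f) - mulX (Sum.inl j) (dX (Sum.inl i) f) := by
  simp [rotation, L, dUpper_inl, sgn]

variable {i j : Fin m}

theorem planeEuler_comm (i j : Fin m) : planeEuler (n := n) i j = planeEuler j i := add_comm _ _

theorem planeLap_comm (i j : Fin m) : planeLap (n := n) i j = planeLap j i := add_comm _ _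

theorem planeEuler_mulX_left (hij : i ≠ j) (f : SuperPoly m n) :
    planeEuler i j (mulX (Sum.inl i) f) =
      mulX (Sum.inl i) (planeEuler i j f) + mulX (Sum.inl i) f := by
  simp only [planeEuler_apply, dX_mulX_self, dX_inl_mulX_inl_of_ne hij, map_add,
    mulX_inl_comm i (Sum.inl j)]
  abel

theorem planeEuler_mulX_of_ne {a : SuperIdx m n} (hi : a ≠ Sum.inl i) (hj : a ≠ Sum.inl j)
    (f : SuperPoly m n) : planeEuler i j (mulX a f) = mulX a (planeEuler i j f) := by
  simp only [planeEuler_apply, dX_inl_mulX_of_ne hi, dX_inl_mulX_of_ne hj, map_add,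
    mulX_inl_comm i a, mulX_inl_comm j a]

theorem planeEuler_dX_left (hij : i ≠ j) (f : SuperPoly m n) :
    planeEuler i j (dX (Sum.inl i) f) =
      dX (Sum.inl i) (planeEuler i j f) - dX (Sum.inl i) f := by
  simp only [planeEuler_apply, dX_mulX_self, dX_inl_mulX_inl_of_ne hij.symm, map_add,
    dX_inl_comm i (Sum.inl j)]
  abel

theorem planeEuler_dX_of_ne {a : SuperIdx m n} (hi : a ≠ Sum.inl i) (hj : a ≠ Sum.inl j)
    (f : SuperPoly m n) : planeEuler i j (dX a f) = dX a (planeEuler i j f) := by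
  simp only [planeEuler_apply, dX_mulX_inl_of_ne hi, dX_mulX_inl_of_ne hj, map_add,
    dX_inl_comm i a, dX_inl_comm j a]

theorem dX_left_planeRsq (hij : i ≠ j) (f : SuperPoly m n) : dX (Sum.inl i) (planeRsq i j f) =
    planeRsq i j (dX (Sum.inl i) f) + (2 : ℝ) • mulX (Sum.inl i) f := by
  simp only [planeRsq_apply, map_add, dX_mulX_self, dX_inl_mulX_inl_of_ne hij.symm]
  module

theorem planeLap_dX (a : SuperIdx m n) (f : SuperPoly m n) :
    planeLap i j (dX a f) = dX a (planeLap i j f) := by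
  simp only [planeLap_apply, map_add, dX_inl_comm i a, dX_inl_comm j a]

theorem planeLap_mulX_of_ne {a : SuperIdx m n} (hi : a ≠ Sum.inl i) (hj : a ≠ Sum.inl j)
    (f : SuperPoly m n) : planeLap i j (mulX a f) = mulX a (planeLap i j f) := by
  simp only [planeLap_apply, map_add, dX_inl_mulX_of_ne hi, dX_inl_mulX_of_ne hj]

theorem planeLap_mulX_left (hij : i ≠ j) (f : SuperPoly m n) :
    planeLap i j (mulX (Sum.inl i) f) =
      mulX (Sum.inl i) (planeLap i j f) + (2 : ℝ) • dX (Sum.inl i) f := by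
  simp only [planeLap_apply, map_add, dX_mulX_self, dX_inl_mulX_inl_of_ne hij]
  module

theorem planeEuler_planeRsq (hij : i ≠ j) (f : SuperPoly m n) :
    planeEuler i j (planeRsq i j f) =
      planeRsq i j (planeEuler i j f) + (2 : ℝ) • planeRsq i j f := by
  have hj : ∀ g, planeEuler (n := n) i j (mulX (Sum.inl j) g) =
      mulX (Sum.inl j) (planeEuler i j g) + mulX (Sum.inl j) g := fun g => by
    rw [planeEuler_comm, planeEuler_mulX_left hij.symm]
  simp only [planeRsq_apply, map_add, planeEuler_mulX_left hij, hj]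
  module

theorem planeEuler_Rsq (f : SuperPoly m n) : planeEuler i j (mulRsq m n f) =
    mulRsq m n (planeEuler i j f) + (2 : ℝ) • planeRsq i j f := by
  simp only [planeEuler_apply, planeRsq_apply, dX_inl_Rsq, map_add, map_smul, mulX_Rsq]
  module

theorem planeEuler_laplacian (f : SuperPoly m n) : planeEuler i j (laplacian m n f) =
    laplacian m n (planeEuler i j f) - (2 : ℝ) • planeLap i j f := by
  simp only [planeEuler_apply, planeLap_apply, dX_laplacian, map_add, laplacian_mulX_inl]
  module

theorem planeLap_planeRsq (hij : i ≠ j) (f : SuperPoly m n) :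
    planeLap i j (planeRsq i j f) =
      planeRsq i j (planeLap i j f) + (4 : ℝ) • planeEuler i j f + (4 : ℝ) • f := by
  have hj : ∀ g, planeLap (n := n) i j (mulX (Sum.inl j) g) =
      mulX (Sum.inl j) (planeLap i j g) + (2 : ℝ) • dX (Sum.inl j) g := fun g => by
    rw [planeLap_comm, planeLap_mulX_left hij.symm]
  simp only [planeRsq_apply, planeEuler_apply, map_add, planeLap_mulX_left hij, hj, dX_mulX_self,
    map_smul]
  module

theorem planeLap_Rsq (f : SuperPoly m n) :
    planeLap i j (mulRsq m n f) =
      mulRsq m n (planeLap i j f) + (4 : ℝ) • planeEuler i j f + (4 : ℝ) • f := by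
  simp only [planeEuler_apply, planeLap_apply, map_add, dX_inl_Rsq, dX_mulX_self, map_smul]
  module

theorem euler_planeRsq (f : SuperPoly m n) : euler m n (planeRsq i j f) =
    planeRsq i j (euler m n f) + (2 : ℝ) • planeRsq i j f := by
  simp only [planeRsq_apply, map_add, euler_mulX]
  module

theorem euler_planeLap (f : SuperPoly m n) : euler m n (planeLap i j f) =
    planeLap i j (euler m n f) - (2 : ℝ) • planeLap i j f := by
  simp only [planeLap_apply, map_add, euler_dX, map_sub]
  module

theorem planeEuler_planeLap (hij : i ≠ j) (f : SuperPoly m n) :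
    planeEuler i j (planeLap i j f) =
      planeLap i j (planeEuler i j f) - (2 : ℝ) • planeLap i j f := by
  have hj : ∀ g, planeEuler (n := n) i j (dX (Sum.inl j) g) =
      dX (Sum.inl j) (planeEuler i j g) - dX (Sum.inl j) g := fun g => by
    rw [planeEuler_comm, planeEuler_dX_left hij.symm]
  simp only [planeLap_apply, map_add, planeEuler_dX_left hij, hj, map_sub]
  module

theorem rotation_planeRsq (hij : i ≠ j) (f : SuperPoly m n) :
    rotation i j (planeRsq i j f) = planeRsq i j (rotation i j f) := by
  simp only [rotation_apply, planeRsq_apply, map_add, map_sub, dX_mulX_self,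
    dX_inl_mulX_inl_of_ne hij, dX_inl_mulX_inl_of_ne hij.symm, mulX_inl_comm i (Sum.inl j)]
  module

theorem planeEuler_rotation (hij : i ≠ j) (f : SuperPoly m n) :
    planeEuler i j (rotation i j f) = rotation i j (planeEuler i j f) := by
  simp only [rotation_apply, planeEuler_apply, map_add, map_sub, dX_mulX_self,
    dX_inl_mulX_inl_of_ne hij, dX_inl_mulX_inl_of_ne hij.symm, mulX_inl_comm i (Sum.inl j),
    dX_inl_comm i (Sum.inl j)]
  abel

theorem euler_rotation (f : SuperPoly m n) :
    euler m n (rotation i j f) = rotation i j (euler m n f) :=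
  LinearMap.congr_fun (commute_euler_L (Sum.inl i) (Sum.inl j)).eq f

theorem planeLap_rotation (hij : i ≠ j) (f : SuperPoly m n) :
    planeLap i j (rotation i j f) = rotation i j (planeLap i j f) := by
  simp only [rotation_apply, planeLap_apply, map_add, map_sub, dX_mulX_self,
    dX_inl_mulX_inl_of_ne hij, dX_inl_mulX_inl_of_ne hij.symm,
    dX_inl_comm i (Sum.inl j)]
  abel

theorem euler_eq_planeEuler_add (hij : i ≠ j) (f : SuperPoly m n) :
    euler m n f = planeEuler i j f +
      ∑ a ∈ Finset.univ \ {Sum.inl i, Sum.inl j}, mulX a (dX a f) := by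
  have h : planeEuler i j f =
      ∑ a ∈ ({Sum.inl i, Sum.inl j} : Finset (SuperIdx m n)), mulX a (dX a f) := by
    rw [Finset.sum_pair (by simpa using hij), planeEuler_apply]
  rw [h, add_comm, Finset.sum_sdiff (Finset.subset_univ _), euler, LinearMap.sum_apply]
  rfl

/-! ### Spectra of the Euler operators -/

theorem dX_tmul_one (a : SuperIdx m n) : dX a (tmul 1 1) = 0 := by
  rcases a with a | a
  · rw [dX_inl_tmul, Derivation.map_one_eq_zero]
    exact TensorProduct.zero_tmul _ _
  · rw [dX_inr_tmul, CliffordAlgebra.contractLeft_one]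
    exact TensorProduct.tmul_zero _ _

theorem iSup_bidegree (hij : i ≠ j) : (⨆ t : ℕ × ℕ, (planeEuler (n := n) i j).eigenspace (t.1 : ℝ) ⊓
    (euler m n).eigenspace ((t.1 + t.2 : ℕ) : ℝ)) = ⊤ := by
  refine eq_top_of_mulX_mem _ ?_ fun a f hf => ?_
  · refine Submodule.mem_iSup_of_mem (0, 0) ⟨?_, ?_⟩ <;>
      rw [SetLike.mem_coe, Module.End.mem_eigenspace_iff]
    · simp [planeEuler_apply, dX_tmul_one]
    · simp [euler, dX_tmul_one]
  · induction hf using Submodule.iSup_induction' with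
    | mem t x hx =>
      obtain ⟨h1, h2⟩ := hx
      rw [SetLike.mem_coe, Module.End.mem_eigenspace_iff] at h1 h2
      have hE : euler m n (mulX a x) = ((t.1 + t.2 + 1 : ℕ) : ℝ) • mulX a x := by
        rw [euler_mulX, h2, map_smul]; push_cast; module
      by_cases hi : a = Sum.inl i
      · refine Submodule.mem_iSup_of_mem (t.1 + 1, t.2)
          ⟨?_, Module.End.mem_eigenspace_iff.2 (by rw [hE, Nat.add_right_comm])⟩
        rw [SetLike.mem_coe, Module.End.mem_eigenspace_iff, hi, planeEuler_mulX_left hij, h1,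
          map_smul]
        push_cast; module
      by_cases hj : a = Sum.inl j
      · refine Submodule.mem_iSup_of_mem (t.1 + 1, t.2)
          ⟨?_, Module.End.mem_eigenspace_iff.2 (by rw [hE, Nat.add_right_comm])⟩
        rw [SetLike.mem_coe, Module.End.mem_eigenspace_iff, hj, planeEuler_comm,
          planeEuler_mulX_left hij.symm, planeEuler_comm, h1, map_smul]
        push_cast; module
      · refine Submodule.mem_iSup_of_mem (t.1, t.2 + 1) ⟨?_, Module.End.mem_eigenspace_iff.2 hE⟩
        rw [SetLike.mem_coe, Module.End.mem_eigenspace_iff, planeEuler_mulX_of_ne hi hj, h1,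
          map_smul]
    | zero => rw [map_zero]; exact zero_mem _
    | add x y _ _ hx hy => rw [map_add]; exact add_mem hx hy

theorem iSup_planeEuler (hij : i ≠ j) :
    (⨆ t : ℕ, (planeEuler (n := n) i j).eigenspace (t : ℝ)) = ⊤ := by
  refine eq_top_iff.2 ((iSup_bidegree (n := n) hij).ge.trans (iSup_le fun t => ?_))
  exact inf_le_left.trans (le_iSup (fun t : ℕ => (planeEuler (n := n) i j).eigenspace (t : ℝ)) t.1)

theorem exists_mem_eigenBelow_planeEuler (hij : i ≠ j) (f : SuperPoly m n) :
    ∃ N, f ∈ (planeEuler i j).eigenBelow (fun t => (t : ℝ)) N :=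
  Module.End.exists_mem_eigenBelow (by rw [iSup_planeEuler hij]; exact Submodule.mem_top)

theorem eq_zero_of_planeEuler_apply (hij : i ≠ j) {f : SuperPoly m n} {μ : ℝ}
    (hf : planeEuler i j f = μ • f) (hμ : ∀ t : ℕ, (t : ℝ) ≠ μ) : f = 0 := by
  obtain ⟨N, hN⟩ := exists_mem_eigenBelow_planeEuler hij f
  exact Module.End.eq_zero_of_mem_eigenBelow hf hN fun t _ => hμ t

/-- A superpolynomial of degree `k` is a sum of superpolynomials of degree `k` that are homogeneous
in the two plane coordinates. -/
theorem bidegree_induction (hij : i ≠ j) {k : ℕ} (S : Submodule ℝ (SuperPoly m n))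
    (hS : ∀ (p : ℕ) (f : SuperPoly m n), p ≤ k → planeEuler i j f = (p : ℝ) • f →
      euler m n f = (k : ℝ) • f → f ∈ S) {f : SuperPoly m n} (hf : euler m n f = (k : ℝ) • f) :
    f ∈ S := by
  set c : ℕ → ℝ := fun t => if t < k then (t : ℝ) else (t + 1 : ℕ) with hc
  have hck : ∀ t, c t ≠ k := fun t h => by
    by_cases ht : t < k
    · simp only [hc, if_pos ht, Nat.cast_inj] at h; omega
    · simp only [hc, if_neg ht, Nat.cast_inj] at h; omega
  have key : ∀ g : SuperPoly m n, ∃ a ∈ S, euler m n a = (k : ℝ) • a ∧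
      ∃ N, g - a ∈ (euler m n).eigenBelow c N := by
    intro g
    have hg : g ∈ (⊤ : Submodule ℝ (SuperPoly m n)) := Submodule.mem_top
    rw [← iSup_bidegree hij] at hg
    induction hg using Submodule.iSup_induction' with
    | mem t x hx =>
      have h1 := Module.End.mem_eigenspace_iff.1 hx.1
      have h2 := Module.End.mem_eigenspace_iff.1 hx.2
      obtain h | h | h := lt_trichotomy (t.1 + t.2) k
      · refine ⟨0, zero_mem _, by simp, t.1 + t.2 + 1, ?_⟩
        rw [sub_zero]
        refine Module.End.mem_eigenBelow (t := t.1 + t.2) (Nat.lt_succ_self _) ?_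
        simpa only [hc, if_pos h] using h2
      · rw [h] at h2
        exact ⟨x, hS t.1 x (by omega) h1 h2, h2, 0, by simp⟩
      · refine ⟨0, zero_mem _, by simp, t.1 + t.2, ?_⟩
        rw [sub_zero]
        refine Module.End.mem_eigenBelow (t := t.1 + t.2 - 1) (by omega) ?_
        have h3 : ¬ t.1 + t.2 - 1 < k := by omega
        have h4 : t.1 + t.2 - 1 + 1 = t.1 + t.2 := by omega
        simpa only [hc, if_neg h3, h4] using h2
    | zero => exact ⟨0, zero_mem _, by simp, 0, by simp⟩
    | add x y _ _ hx hy =>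
      obtain ⟨a, ha, ha', N, hN⟩ := hx
      obtain ⟨b, hb, hb', N', hN'⟩ := hy
      refine ⟨a + b, add_mem ha hb, by rw [map_add, ha', hb', smul_add], max N N', ?_⟩
      rw [add_sub_add_comm]
      exact add_mem (Module.End.eigenBelow_mono (le_max_left _ _) hN)
        (Module.End.eigenBelow_mono (le_max_right _ _) hN')
  obtain ⟨a, ha, ha', N, hN⟩ := key f
  have h0 : f - a = 0 := Module.End.eq_zero_of_mem_eigenBelow (μ := k)
    (by rw [map_sub, hf, ha', smul_sub]) hN fun t _ => hck t
  rw [sub_eq_zero.1 h0]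
  exact ha

/-! ### Plane harmonics -/

/-- The superpolynomials of degree `k` that are homogeneous of degree `p` and harmonic in the two
plane coordinates. -/
def planeHarm (n : ℕ) (i j : Fin m) (p k : ℝ) : Submodule ℝ (SuperPoly m n) where
  carrier := {f | planeEuler i j f = p • f ∧ euler m n f = k • f ∧ planeLap i j f = 0}
  add_mem' := by
    rintro f g ⟨h1, h2, h3⟩ ⟨h4, h5, h6⟩
    exact ⟨by rw [map_add, h1, h4, smul_add], by rw [map_add, h2, h5, smul_add],
      by rw [map_add, h3, h6, add_zero]⟩
  zero_mem' := by simp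
  smul_mem' := by
    rintro c f ⟨h1, h2, h3⟩
    exact ⟨by rw [map_smul, h1, smul_comm], by rw [map_smul, h2, smul_comm],
      by rw [map_smul, h3, smul_zero]⟩

theorem mem_planeHarm {p k : ℝ} {f : SuperPoly m n} : f ∈ planeHarm n i j p k ↔
    planeEuler i j f = p • f ∧ euler m n f = k • f ∧ planeLap i j f = 0 := Iff.rfl

theorem planeHarm_comm (i j : Fin m) (p k : ℝ) : planeHarm n i j p k = planeHarm n j i p k := by
  ext f
  simp only [mem_planeHarm, planeEuler_comm i j, planeLap_comm i j]

section

variable {p k : ℝ} {f : SuperPoly m n}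

theorem mulX_mem_planeHarm {a : SuperIdx m n} (hi : a ≠ Sum.inl i) (hj : a ≠ Sum.inl j)
    (hf : f ∈ planeHarm n i j p k) : mulX a f ∈ planeHarm n i j p (k + 1) := by
  obtain ⟨h1, h2, h3⟩ := hf
  exact ⟨by rw [planeEuler_mulX_of_ne hi hj, h1, map_smul],
    by rw [euler_mulX, h2, map_smul]; module, by rw [planeLap_mulX_of_ne hi hj, h3, map_zero]⟩

theorem dX_mem_planeHarm {a : SuperIdx m n} (hi : a ≠ Sum.inl i) (hj : a ≠ Sum.inl j)
    (hf : f ∈ planeHarm n i j p k) : dX a f ∈ planeHarm n i j p (k - 1) := by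
  obtain ⟨h1, h2, h3⟩ := hf
  exact ⟨by rw [planeEuler_dX_of_ne hi hj, h1, map_smul],
    by rw [euler_dX, h2, map_smul]; module, by rw [planeLap_dX, h3, map_zero]⟩

theorem dX_left_mem_planeHarm (hij : i ≠ j) (hf : f ∈ planeHarm n i j p k) :
    dX (Sum.inl i) f ∈ planeHarm n i j (p - 1) (k - 1) := by
  obtain ⟨h1, h2, h3⟩ := hf
  exact ⟨by rw [planeEuler_dX_left hij, h1, map_smul]; module,
    by rw [euler_dX, h2, map_smul]; module, by rw [planeLap_dX, h3, map_zero]⟩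

theorem dX_right_mem_planeHarm (hij : i ≠ j) (hf : f ∈ planeHarm n i j p k) :
    dX (Sum.inl j) f ∈ planeHarm n i j (p - 1) (k - 1) := by
  rw [planeHarm_comm] at hf ⊢
  exact dX_left_mem_planeHarm hij.symm hf

theorem exists_dUpper_eq (s : Fin 2 × Fin n) : ∃ (t : Fin 2 × Fin n) (c : ℝ), c ≠ 0 ∧
    dUpper (m := m) (Sum.inr s) = c • dX (Sum.inr t) := by
  obtain ⟨s, l⟩ := s
  fin_cases s
  · exact ⟨(1, l), 2, by norm_num, dUpper_inr_zero l⟩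
  · exact ⟨(0, l), -2, by norm_num, dUpper_inr_one l⟩

theorem exists_dX_eq (s : Fin 2 × Fin n) : ∃ (t : Fin 2 × Fin n) (c : ℝ),
    dX (m := m) (Sum.inr s) = c • dUpper (Sum.inr t) := by
  obtain ⟨s, l⟩ := s
  fin_cases s
  · refine ⟨(1, l), -1 / 2, ?_⟩
    rw [dUpper_inr_one, smul_smul]; norm_num
  · refine ⟨(0, l), 1 / 2, ?_⟩
    rw [dUpper_inr_zero, smul_smul]; norm_num

theorem dUpper_mem_planeHarm {a : SuperIdx m n} (hi : a ≠ Sum.inl i) (hj : a ≠ Sum.inl j)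
    (hf : f ∈ planeHarm n i j p k) : dUpper a f ∈ planeHarm n i j p (k - 1) := by
  rcases a with a | a
  · rw [dUpper_inl]; exact dX_mem_planeHarm hi hj hf
  · obtain ⟨t, c, -, h⟩ := exists_dUpper_eq (m := m) a
    rw [h]
    exact Submodule.smul_mem _ _ (dX_mem_planeHarm (by simp) (by simp) hf)

/-- Multiplication by `R² - x_i² - x_j²`. -/
def restRsq (i j : Fin m) : Module.End ℝ (SuperPoly m n) := mulRsq m n - planeRsq i j

theorem restRsq_mem_planeHarm (hij : i ≠ j) (hf : f ∈ planeHarm n i j p k) :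
    restRsq i j f ∈ planeHarm n i j p (k + 2) := by
  obtain ⟨h1, h2, h3⟩ := hf
  refine ⟨?_, ?_, ?_⟩
  · rw [restRsq, LinearMap.sub_apply, map_sub, planeEuler_Rsq, planeEuler_planeRsq hij, h1, map_smul,
      map_smul]
    module
  · rw [restRsq, LinearMap.sub_apply, map_sub, euler_Rsq, euler_planeRsq, h2, map_smul, map_smul]
    module
  · rw [restRsq, LinearMap.sub_apply, map_sub, planeLap_Rsq, planeLap_planeRsq hij, h3,
      map_zero, map_zero]
    module

theorem restRsq_pow_mem_planeHarm (hij : i ≠ j) (hf : f ∈ planeHarm n i j p k) (l : ℕ) :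
    (restRsq i j ^ l) f ∈ planeHarm n i j p (k + 2 * l) := by
  induction l with
  | zero => simpa using hf
  | succ l ih =>
    rw [pow_succ', Module.End.mul_apply]
    have := restRsq_mem_planeHarm hij ih
    convert this using 2
    push_cast; ring

theorem dX_right_sq (hf : f ∈ planeHarm n i j p k) :
    dX (Sum.inl j) (dX (Sum.inl j) f) = -dX (Sum.inl i) (dX (Sum.inl i) f) :=
  eq_neg_of_add_eq_zero_right hf.2.2

theorem smul_dX_left_sq (hij : i ≠ j) (hf : f ∈ planeHarm n i j p k) :
    mulX (Sum.inl i) (mulX (Sum.inl i) (dX (Sum.inl i) (dX (Sum.inl i) f))) +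
      mulX (Sum.inl j) (mulX (Sum.inl i) (dX (Sum.inl i) (dX (Sum.inl j) f))) =
      (p - 1) • mulX (Sum.inl i) (dX (Sum.inl i) f) := by
  have := (dX_left_mem_planeHarm hij hf).1
  rw [planeEuler_apply] at this
  have := congrArg (mulX (Sum.inl i)) this
  rwa [map_add, map_smul, mulX_inl_comm j (Sum.inl i), dX_inl_comm i (Sum.inl j)] at this

theorem smul_dX_right_sq (hij : i ≠ j) (hf : f ∈ planeHarm n i j p k) :
    mulX (Sum.inl j) (mulX (Sum.inl i) (dX (Sum.inl i) (dX (Sum.inl j) f))) -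
      mulX (Sum.inl j) (mulX (Sum.inl j) (dX (Sum.inl i) (dX (Sum.inl i) f))) =
      (p - 1) • mulX (Sum.inl j) (dX (Sum.inl j) f) := by
  have := (dX_right_mem_planeHarm hij hf).1
  have h3 := dX_right_sq hf
  rw [planeEuler_apply, h3, map_neg, ← sub_eq_add_neg] at this
  have := congrArg (mulX (Sum.inl j)) this
  rwa [map_sub, map_smul] at this

theorem rotation_sq (hij : i ≠ j) (hf : f ∈ planeHarm n i j p k) :
    rotation i j (rotation i j f) = -(p ^ 2) • f := by
  have h1 := smul_dX_left_sq hij hf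
  have h2 := smul_dX_right_sq hij hf
  have h3 := dX_right_sq hf
  have h4 := hf.1
  rw [planeEuler_apply] at h4
  simp only [rotation_apply, map_sub, map_add, dX_mulX_self, dX_inl_mulX_inl_of_ne hij,
    dX_inl_mulX_inl_of_ne hij.symm, mulX_inl_comm j (Sum.inl i), dX_inl_comm i (Sum.inl j), h3,
    map_neg]
  linear_combination (norm := module) (-1 : ℝ) • h1 + (-1 : ℝ) • h2 - p • h4

theorem rotation_mem_planeHarm (hij : i ≠ j) (hf : f ∈ planeHarm n i j p k) :
    rotation i j f ∈ planeHarm n i j p k := by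
  obtain ⟨h1, h2, h3⟩ := hf
  exact ⟨by rw [planeEuler_rotation hij, h1, map_smul], by rw [euler_rotation, h2, map_smul],
    by rw [planeLap_rotation hij, h3, map_zero]⟩

end

theorem exists_raise (hij : i ≠ j) {p : ℕ} {k : ℝ} {f : SuperPoly m n}
    (hf : f ∈ planeHarm n i j p k) : ∃ g ∈ planeHarm n i j (p + 1 : ℕ) (k + 1), ∃ c d : ℝ, c ≠ 0 ∧
      mulX (Sum.inl i) f = g + d • planeRsq i j (dX (Sum.inl i) f) ∧
      dX (Sum.inl i) g = c • f := by
  have hd := dX_left_mem_planeHarm hij hf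
  obtain rfl | hp := Nat.eq_zero_or_pos p
  · have h0 : dX (Sum.inl i) f = 0 := eq_zero_of_planeEuler_apply hij hd.1 fun t => by
      have : (0 : ℝ) ≤ t := t.cast_nonneg
      intro h; rw [h] at this; norm_num at this
    refine ⟨mulX (Sum.inl i) f, ⟨?_, ?_, ?_⟩, 1, 0, one_ne_zero, by simp, ?_⟩
    · rw [planeEuler_mulX_left hij, hf.1, map_smul]; push_cast; module
    · rw [euler_mulX, hf.2.1, map_smul]; module
    · rw [planeLap_mulX_left hij, hf.2.2, h0]; simp
    · rw [dX_mulX_self, h0]; simp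
  have hp' : (p : ℝ) ≠ 0 := by positivity
  refine ⟨mulX (Sum.inl i) f - (1 / (2 * p) : ℝ) • planeRsq i j (dX (Sum.inl i) f), ⟨?_, ?_, ?_⟩,
    (p + 1) / 2, 1 / (2 * p), by positivity, by module, ?_⟩
  · rw [map_sub, map_smul, planeEuler_mulX_left hij, planeEuler_planeRsq hij, hd.1, hf.1, map_smul,
      map_smul]
    push_cast; module
  · rw [map_sub, map_smul, euler_mulX, euler_planeRsq, hd.2.1, hf.2.1, map_smul, map_smul]
    module
  · rw [map_sub, map_smul, planeLap_mulX_left hij, planeLap_planeRsq hij, hd.1, hd.2.2, hf.2.2]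
    simp only [map_zero, zero_add]
    match_scalars
    field_simp
    ring
  · have h1 := smul_dX_left_sq hij hf
    have h2 := smul_dX_right_sq hij hf
    have h4 := hf.1
    rw [planeEuler_apply] at h4
    rw [map_sub, map_smul, dX_mulX_self, dX_left_planeRsq hij, planeRsq_apply]
    have key : mulX (Sum.inl i) (mulX (Sum.inl i) (dX (Sum.inl i) (dX (Sum.inl i) f))) +
        mulX (Sum.inl j) (mulX (Sum.inl j) (dX (Sum.inl i) (dX (Sum.inl i) f))) +
        (2 : ℝ) • mulX (Sum.inl i) (dX (Sum.inl i) f) =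
        (2 * p : ℝ) • mulX (Sum.inl i) (dX (Sum.inl i) f) - (p * (p - 1) : ℝ) • f := by
      linear_combination (norm := module) (1 : ℝ) • h1 - (1 : ℝ) • h2 - ((p : ℝ) - 1) • h4
    rw [key]
    match_scalars <;> field_simp <;> ring

/-! ### The Fischer decomposition in the plane -/

theorem planeEuler_planeRsq_pow (hij : i ≠ j) {p : ℝ} {f : SuperPoly m n}
    (hf : planeEuler i j f = p • f) (l : ℕ) :
    planeEuler i j ((planeRsq i j ^ l) f) = (p + 2 * l) • (planeRsq i j ^ l) f := by
  induction l with
  | zero => simpa using hf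
  | succ l ih =>
    rw [pow_succ', Module.End.mul_apply, planeEuler_planeRsq hij, ih, map_smul]
    push_cast; module

theorem planeLap_planeRsq_pow (hij : i ≠ j) {p k : ℝ} {f : SuperPoly m n}
    (hf : f ∈ planeHarm n i j p k) (l : ℕ) :
    planeLap i j ((planeRsq i j ^ (l + 1)) f) =
      (4 * (l + 1) * (p + l + 1)) • (planeRsq i j ^ l) f := by
  induction l with
  | zero =>
    rw [zero_add, pow_one, planeLap_planeRsq hij, hf.1, hf.2.2, map_zero, pow_zero,
      Module.End.one_apply]
    push_cast; module
  | succ l ih =>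
    rw [pow_succ', Module.End.mul_apply, planeLap_planeRsq hij, ih,
      planeEuler_planeRsq_pow hij hf.1, map_smul, ← Module.End.mul_apply, ← pow_succ']
    push_cast; module

/-- The span of the products of powers of `x_i² + x_j²` with plane harmonics, in plane degree `p` and
degree `k`. -/
def planeFischer (n : ℕ) (i j : Fin m) (p : ℕ) (k : ℝ) : Submodule ℝ (SuperPoly m n) :=
  Submodule.span ℝ {g | ∃ l q : ℕ, q + 2 * l = p ∧ ∃ h ∈ planeHarm n i j q (k - 2 * l),
    (planeRsq i j ^ l) h = g}

theorem planeRsq_mem_planeFischer {p : ℕ} {k : ℝ} {f : SuperPoly m n}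
    (hf : f ∈ planeFischer n i j p k) : planeRsq i j f ∈ planeFischer n i j (p + 2) (k + 2) := by
  refine (Submodule.span_le (p := (planeFischer n i j (p + 2) (k + 2)).comap (planeRsq i j))).2 ?_ hf
  rintro _ ⟨l, q, h1, h, h2, rfl⟩
  refine Submodule.subset_span ⟨l + 1, q, by omega, h, ?_, ?_⟩
  · rwa [show k + 2 - 2 * ((l + 1 : ℕ) : ℝ) = k - 2 * l by push_cast; ring]
  · rw [pow_succ', Module.End.mul_apply]

theorem euler_planeRsq_pow {k : ℝ} {f : SuperPoly m n} (hf : euler m n f = k • f) (l : ℕ) :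
    euler m n ((planeRsq i j ^ l) f) = (k + 2 * l) • (planeRsq i j ^ l) f := by
  induction l with
  | zero => simpa using hf
  | succ l ih =>
    rw [pow_succ', Module.End.mul_apply, euler_planeRsq, ih, map_smul]
    push_cast; module

theorem homogeneous_of_mem_planeFischer (hij : i ≠ j) {p : ℕ} {k : ℝ} {f : SuperPoly m n}
    (hf : f ∈ planeFischer n i j p k) :
    planeEuler i j f = (p : ℝ) • f ∧ euler m n f = k • f := by
  have h : planeFischer n i j p k ≤
      (planeEuler (n := n) i j).eigenspace (p : ℝ) ⊓ (euler m n).eigenspace k := by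
    refine Submodule.span_le.2 ?_
    rintro _ ⟨l, q, rfl, h, h2, rfl⟩
    refine ⟨Module.End.mem_eigenspace_iff.2 ?_, Module.End.mem_eigenspace_iff.2 ?_⟩
    · rw [planeEuler_planeRsq_pow hij h2.1]; push_cast; rfl
    · rw [euler_planeRsq_pow h2.2.1, sub_add_cancel]
  exact ⟨Module.End.mem_eigenspace_iff.1 (h hf).1, Module.End.mem_eigenspace_iff.1 (h hf).2⟩

theorem exists_planeLap_planeRsq_eq (hij : i ≠ j) {p : ℕ} {k : ℝ} {f : SuperPoly m n}
    (hf : f ∈ planeFischer n i j p k) :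
    ∃ g ∈ planeFischer n i j p k, planeLap i j (planeRsq i j g) = f := by
  refine (Submodule.span_le (p := (planeFischer n i j p k).map
    (planeLap i j * planeRsq i j : Module.End ℝ (SuperPoly m n)))).2 ?_ hf
  rintro _ ⟨l, q, h1, h, h2, rfl⟩
  have hc : (4 * (l + 1) * (q + l + 1) : ℝ) ≠ 0 := by positivity
  refine ⟨(4 * (l + 1) * (q + l + 1) : ℝ)⁻¹ • (planeRsq i j ^ l) h,
    Submodule.smul_mem _ _ (Submodule.subset_span ⟨l, q, h1, h, h2, rfl⟩), ?_⟩
  rw [Module.End.mul_apply, map_smul, map_smul, ← Module.End.mul_apply (planeRsq i j),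
    ← pow_succ', planeLap_planeRsq_pow hij h2, smul_smul, inv_mul_cancel₀ hc, one_smul]

theorem planeEuler_planeLap_apply (hij : i ≠ j) {p : ℝ} {f : SuperPoly m n}
    (hf : planeEuler i j f = p • f) :
    planeEuler i j (planeLap i j f) = (p - 2) • planeLap i j f := by
  rw [planeEuler_planeLap hij, hf, map_smul]; module

theorem planeLap_eq_zero (hij : i ≠ j) {p : ℕ} (hp : p < 2) {f : SuperPoly m n}
    (hf : planeEuler i j f = (p : ℝ) • f) : planeLap i j f = 0 := by
  refine eq_zero_of_planeEuler_apply hij (planeEuler_planeLap_apply hij hf) fun t h => ?_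
  have h1 : (0 : ℝ) ≤ t := t.cast_nonneg
  have h2 : (p : ℝ) < 2 := by exact_mod_cast hp
  linarith

theorem mem_planeFischer (hij : i ≠ j) (p : ℕ) : ∀ {k : ℝ} {f : SuperPoly m n},
    planeEuler i j f = (p : ℝ) • f → euler m n f = k • f → f ∈ planeFischer n i j p k := by
  induction p using Nat.strong_induction_on with
  | _ p ih =>
    intro k f h1 h2
    have hsub : planeHarm n i j p k ≤ planeFischer n i j p k := fun h hh =>
      Submodule.subset_span ⟨0, p, by simp, h, by simpa using hh, by simp⟩
    obtain hp | hp := lt_or_ge p 2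
    · exact hsub ⟨h1, h2, planeLap_eq_zero hij hp h1⟩
    obtain ⟨p, rfl⟩ := Nat.exists_eq_add_of_le' hp
    have hL : planeLap i j f ∈ planeFischer n i j p (k - 2) := by
      refine ih p (by omega) ?_ ?_
      · rw [planeEuler_planeLap_apply hij h1]; push_cast; module
      · rw [euler_planeLap, h2, map_smul]; module
    obtain ⟨g, hg, hgf⟩ := exists_planeLap_planeRsq_eq hij hL
    obtain ⟨hg1, hg2⟩ := homogeneous_of_mem_planeFischer hij hg
    have hd : f - planeRsq i j g ∈ planeHarm n i j (p + 2 : ℕ) k := by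
      refine ⟨?_, ?_, by rw [map_sub, hgf, sub_self]⟩
      · rw [map_sub, planeEuler_planeRsq hij, hg1, h1, map_smul]; push_cast; module
      · rw [map_sub, euler_planeRsq, hg2, h2, map_smul]; module
    have := add_mem (hsub hd) (by simpa using planeRsq_mem_planeFischer hg)
    rwa [sub_add_cancel] at this

theorem eq_zero_of_planeRsq_planeLap (hij : i ≠ j) (p : ℕ) : ∀ {μ : ℝ} {f : SuperPoly m n},
    0 < μ → planeEuler i j f = (p : ℝ) • f → planeRsq i j (planeLap i j f) = -μ • f → f = 0 := by
  induction p using Nat.strong_induction_on with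
  | _ p ih =>
    intro μ f hμ h1 h2
    have key : planeLap i j f = 0 → f = 0 := fun h => by
      rw [h, map_zero] at h2
      exact (smul_eq_zero.1 h2.symm).resolve_left (by linarith)
    obtain hp | hp := lt_or_ge p 2
    · exact key (planeLap_eq_zero hij hp h1)
    obtain ⟨p, rfl⟩ := Nat.exists_eq_add_of_le' hp
    have hE : planeEuler i j (planeLap i j f) = (p : ℝ) • planeLap i j f := by
      rw [planeEuler_planeLap_apply hij h1]; push_cast; module
    refine key (ih p (by omega) (μ := μ + 4 * p + 4) (by positivity) hE ?_)
    have h3 := congrArg (planeLap i j) h2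
    rw [planeLap_planeRsq hij, hE, map_smul] at h3
    linear_combination (norm := module) (1 : ℝ) • h3

theorem planeRsq_injective (i j : Fin m) (hij : i ≠ j) :
    Function.Injective (planeRsq (n := n) i j) := by
  have := sum_mulX_inl_sq_injective (n := n) (s := {i, j}) ⟨i, by simp⟩
  rwa [Finset.sum_pair hij] at this

theorem planeEuler_restRsq (hij : i ≠ j) {p : ℝ} {f : SuperPoly m n}
    (hf : planeEuler i j f = p • f) : planeEuler i j (restRsq i j f) = p • restRsq i j f := by
  rw [restRsq, LinearMap.sub_apply, map_sub, planeEuler_Rsq, planeEuler_planeRsq hij, hf, map_smul,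
    map_smul]
  module

theorem planeRsq_Rsq (f : SuperPoly m n) :
    planeRsq i j (mulRsq m n f) = mulRsq m n (planeRsq i j f) := by
  simp only [planeRsq_apply, mulX_Rsq, map_add]

/-- A plane harmonic that is divisible by `R²` vanishes. -/
theorem eq_zero_of_mem_range_Rsq (hij : i ≠ j) {q : ℕ} {k : ℝ} {h : SuperPoly m n}
    (hh : h ∈ planeHarm n i j q k) (hR : h ∈ LinearMap.range (mulRsq m n)) : h = 0 := by
  obtain ⟨a, ha⟩ := hR
  obtain ⟨N, hN⟩ := exists_mem_eigenBelow_planeEuler hij a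
  induction N generalizing a with
  | zero =>
    rw [Module.End.eigenBelow_zero, Submodule.mem_bot] at hN
    rw [← ha, hN, map_zero]
  | succ N ih =>
    obtain ⟨b, hb, c, hc, rfl⟩ := Module.End.exists_of_mem_eigenBelow_succ hN
    have hrest : restRsq i j b + mulRsq m n c ∈
        (planeEuler (n := n) i j).eigenBelow (fun t => (t : ℝ)) (N + 2) := by
      refine add_mem (Module.End.mem_eigenBelow (by omega) (planeEuler_restRsq hij hb))
        (Module.End.eigenBelow_le (S := ((planeEuler (n := n) i j).eigenBelow
          (fun t => (t : ℝ)) (N + 2)).comap (mulRsq m n)) (fun t ht g hg => ?_) hc)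
      have hs : mulRsq m n g = restRsq i j g + planeRsq i j g := by
        rw [restRsq, LinearMap.sub_apply, sub_add_cancel]
      rw [Submodule.mem_comap, hs]
      refine add_mem (Module.End.mem_eigenBelow (by omega) (planeEuler_restRsq hij hg))
        (Module.End.mem_eigenBelow (t := t + 2) (by omega) ?_)
      rw [planeEuler_planeRsq hij, hg, map_smul]; push_cast; module
    have hsplit : h = planeRsq i j b + (restRsq i j b + mulRsq m n c) := by
      rw [← ha, restRsq, LinearMap.sub_apply, map_add]; abel
    have hrb : planeEuler i j (planeRsq i j b) = ((N + 2 : ℕ) : ℝ) • planeRsq i j b := by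
      rw [planeEuler_planeRsq hij, hb, map_smul]; push_cast; module
    obtain hq | hq | hq := lt_trichotomy q (N + 2)
    · have h0 : planeRsq i j b = 0 := by
        refine Module.End.eq_zero_of_mem_eigenBelow hrb (N := N + 2) (c := fun t => (t : ℝ)) ?_
          fun t ht => by exact_mod_cast ht.ne
        rw [eq_sub_of_add_eq hsplit.symm]
        exact sub_mem (Module.End.mem_eigenBelow hq hh.1) hrest
      have hb0 : b = 0 := planeRsq_injective i j hij (by rw [h0, map_zero])
      exact ih c (by rw [← ha, hb0, zero_add]) hc
    · have h0 : h = planeRsq i j b := by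
        refine sub_eq_zero.1 (Module.End.eq_zero_of_mem_eigenBelow (A := planeEuler i j)
          (μ := ((N + 2 : ℕ) : ℝ)) (N := N + 2) (c := fun t => (t : ℝ)) ?_ ?_
          fun t ht => by exact_mod_cast ht.ne)
        · rw [map_sub, hrb, hh.1, hq, smul_sub]
        · rw [sub_eq_of_eq_add' hsplit]; exact hrest
      have hb0 : b = 0 := by
        refine eq_zero_of_planeRsq_planeLap hij N (μ := 4 * N + 4) (by positivity) hb ?_
        have := hh.2.2
        rw [h0, planeLap_planeRsq hij, hb] at this
        linear_combination (norm := module) (1 : ℝ) • this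
      rw [h0, hb0, map_zero]
    · refine Module.End.eq_zero_of_mem_eigenBelow hh.1 (N := N + 3) (c := fun t => (t : ℝ)) ?_
        fun t ht => by simp; omega
      rw [hsplit]
      exact add_mem (Module.End.mem_eigenBelow (by omega) hrb)
        (Module.End.eigenBelow_mono (by omega) hrest)

/-! ### Weights of the rotation of the plane -/

/-- The span of the plane harmonics of degree `k` with plane degree `< q` and of the multiples of
`R²`. -/
def radialBelow (n : ℕ) (i j : Fin m) (k : ℝ) (q : ℕ) : Submodule ℝ (SuperPoly m n) :=
  (⨆ p ∈ Finset.range q, planeHarm n i j (p : ℝ) k) ⊔ LinearMap.range (mulRsq m n)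

theorem planeHarm_le_radialBelow {k : ℝ} {p q : ℕ} (hp : p < q) :
    planeHarm n i j p k ≤ radialBelow n i j k q :=
  le_sup_of_le_left (le_iSup₂_of_le (f := fun (p : ℕ) (_ : p ∈ Finset.range q) =>
    planeHarm n i j (p : ℝ) k) p (Finset.mem_range.2 hp) le_rfl)

theorem range_le_radialBelow {k : ℝ} {q : ℕ} :
    LinearMap.range (mulRsq m n) ≤ radialBelow n i j k q := le_sup_right

theorem radialBelow_le {k : ℝ} {q : ℕ} {S : Submodule ℝ (SuperPoly m n)}
    (h : ∀ p < q, planeHarm n i j p k ≤ S) (hR : LinearMap.range (mulRsq m n) ≤ S) :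
    radialBelow n i j k q ≤ S :=
  sup_le (iSup₂_le fun p hp => h p (Finset.mem_range.1 hp)) hR

theorem exists_of_mem_radialBelow_succ {k : ℝ} {q : ℕ} {f : SuperPoly m n}
    (hf : f ∈ radialBelow n i j k (q + 1)) :
    ∃ g ∈ planeHarm n i j q k, ∃ d ∈ radialBelow n i j k q, f = g + d := by
  rw [radialBelow, Finset.range_add_one, Finset.iSup_insert, sup_assoc] at hf
  obtain ⟨g, hg, d, hd, rfl⟩ := Submodule.mem_sup.1 hf
  exact ⟨g, hg, d, hd, rfl⟩

/-- The square of the infinitesimal rotation of the plane. -/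
def rotationSq (n : ℕ) (i j : Fin m) : Module.End ℝ (SuperPoly m n) := rotation i j * rotation i j

theorem rotationSq_apply (f : SuperPoly m n) :
    rotationSq n i j f = rotation i j (rotation i j f) := rfl

theorem rotationSq_planeRsq_pow (hij : i ≠ j) {p k : ℝ} {f : SuperPoly m n}
    (hf : f ∈ planeHarm n i j p k) (l : ℕ) :
    rotationSq n i j ((planeRsq i j ^ l) f) = (-(p ^ 2)) • (planeRsq i j ^ l) f := by
  induction l with
  | zero => rw [pow_zero, Module.End.one_apply, rotationSq_apply, rotation_sq hij hf]
  | succ l ih =>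
    rw [pow_succ', Module.End.mul_apply, rotationSq_apply, rotation_planeRsq hij,
      rotation_planeRsq hij, ← rotationSq_apply, ih, map_smul]

theorem rotationSq_planeHarm (hij : i ≠ j) {p k : ℝ} {f : SuperPoly m n}
    (hf : f ∈ planeHarm n i j p k) : rotationSq n i j f = (-(p ^ 2)) • f := by
  rw [rotationSq_apply, rotation_sq hij hf]

theorem neg_sq_ne {q : ℕ} : ∀ t < q, -((t : ℝ) ^ 2) ≠ -((q : ℝ) ^ 2) := fun t ht h => by
  have h1 : (t : ℝ) ^ 2 = (q : ℝ) ^ 2 := by linarith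
  have h2 : (t : ℝ) = q := (pow_left_inj₀ t.cast_nonneg q.cast_nonneg two_ne_zero).1 h1
  exact ht.ne (by exact_mod_cast h2)

open Polynomial in
/-- The polynomial in the square of the rotation that annihilates the weights below `q`. -/
def weightCut (n : ℕ) (i j : Fin m) (q : ℕ) : Module.End ℝ (SuperPoly m n) :=
  aeval (rotationSq n i j) (∏ t ∈ Finset.range q, (X - C (-((t : ℝ) ^ 2))))

theorem weightCut_apply (hij : i ≠ j) (q : ℕ) (k : ℝ) : ∃ c : ℝ, c ≠ 0 ∧
    ∀ h ∈ planeHarm n i j q k, weightCut n i j q h = c • h :=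
  ⟨_, Module.End.eval_prod_ne_zero (c := fun t : ℕ => -((t : ℝ) ^ 2)) (μ := -((q : ℝ) ^ 2))
    neg_sq_ne, fun h hh =>
    Module.End.aeval_apply_of_apply_eq_smul (A := rotationSq n i j) (f := h)
      (rotationSq_planeHarm hij hh) _⟩

theorem weightCut_eq_zero {p q : ℕ} (hp : p < q) {f : SuperPoly m n}
    (hf : rotationSq n i j f = (-((p : ℝ) ^ 2)) • f) : weightCut n i j q f = 0 :=
  Module.End.aeval_prod_apply_of_mem_eigenBelow (A := rotationSq n i j)
    (c := fun t : ℕ => -((t : ℝ) ^ 2)) (Module.End.mem_eigenBelow hp hf)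

theorem weightCut_Rsq (q : ℕ) (f : SuperPoly m n) :
    weightCut n i j q (mulRsq m n f) = mulRsq m n (weightCut n i j q f) := by
  have h : Commute (mulRsq m n) (rotation i j) := commute_Rsq_L (Sum.inl i) (Sum.inl j)
  have h2 : Algebra.adjoin ℝ {rotationSq n i j} ≤ Subalgebra.centralizer ℝ {mulRsq m n} := by
    refine Algebra.adjoin_le (Set.singleton_subset_iff.2 ?_)
    refine (Subalgebra.mem_centralizer_iff ℝ).2 fun g hg => ?_
    rw [Set.mem_singleton_iff.1 hg]
    exact (h.mul_right h).eq
  have h3 : weightCut n i j q ∈ Subalgebra.centralizer ℝ {mulRsq m n} :=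
    h2 (Polynomial.aeval_mem_adjoin_singleton ℝ (rotationSq n i j))
  exact (LinearMap.congr_fun ((Subalgebra.mem_centralizer_iff ℝ).1 h3 _ rfl) f).symm

theorem weightCut_mem_Uosp (q : ℕ) : weightCut n i j q ∈ Uosp m n := by
  have h : rotation i j ∈ Algebra.adjoin ℝ (osp m n : Set (Module.End ℝ (SuperPoly m n))) :=
    Algebra.subset_adjoin (Submodule.subset_span ⟨(Sum.inl i, Sum.inl j), rfl⟩)
  exact Algebra.adjoin_le (Set.singleton_subset_iff.2 (mul_mem h h))
    (Polynomial.aeval_mem_adjoin_singleton ℝ _)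

theorem eq_zero_of_mem_radialBelow (hij : i ≠ j) {q : ℕ} {k : ℝ} {h : SuperPoly m n}
    (hh : h ∈ planeHarm n i j q k) (hR : h ∈ radialBelow n i j k q) : h = 0 := by
  obtain ⟨c, hc, hcut⟩ := weightCut_apply (n := n) hij q k
  have h1 : weightCut n i j q h ∈ LinearMap.range (mulRsq m n) := by
    refine radialBelow_le (S := (LinearMap.range (mulRsq m n)).comap (weightCut n i j q)) ?_ ?_ hR
    · intro p hp f hf
      rw [Submodule.mem_comap, weightCut_eq_zero hp (rotationSq_planeHarm hij hf)]
      exact zero_mem _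
    · rintro _ ⟨f, rfl⟩
      exact ⟨_, (weightCut_Rsq q f).symm⟩
  rw [hcut h hh] at h1
  refine eq_zero_of_mem_range_Rsq hij hh ?_
  simpa [smul_smul, inv_mul_cancel₀ hc] using Submodule.smul_mem _ c⁻¹ h1

theorem weightCut_mem (hij : i ≠ j) {k : ℕ} {f : SuperPoly m n} (hf : euler m n f = (k : ℝ) • f) :
    weightCut n i j k f ∈ planeHarm n i j k k := by
  refine bidegree_induction hij ((planeHarm n i j k k).comap (weightCut n i j k))
    (fun p g hp h1 h2 => ?_) hf
  refine (Submodule.span_le (p := (planeHarm n i j k k).comap (weightCut n i j k))).2 ?_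
    (mem_planeFischer hij p h1 h2)
  rintro _ ⟨l, q, h3, h, h4, rfl⟩
  rw [SetLike.mem_coe, Submodule.mem_comap]
  obtain hq | rfl := (show q ≤ k by omega).lt_or_eq
  · rw [weightCut_eq_zero hq (rotationSq_planeRsq_pow hij h4 l)]
    exact zero_mem _
  · obtain rfl : l = 0 := by omega
    obtain ⟨c, -, hcut⟩ := weightCut_apply (n := n) hij q q
    have h5 : h ∈ planeHarm n i j q q := by simpa using h4
    rw [pow_zero, Module.End.one_apply, hcut h h5]
    exact Submodule.smul_mem _ _ h5

theorem mem_radialBelow (hij : i ≠ j) {k : ℕ} {f : SuperPoly m n}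
    (hf : euler m n f = (k : ℝ) • f) : f ∈ radialBelow n i j k (k + 1) := by
  refine bidegree_induction hij _ (fun p g hp h1 h2 => ?_) hf
  refine Submodule.span_le.2 ?_ (mem_planeFischer hij p h1 h2)
  rintro _ ⟨l, q, h3, h, h4, rfl⟩
  have key : ∃ a, (planeRsq i j ^ l) h = (-1 : ℝ) ^ l • (restRsq i j ^ l) h + mulRsq m n a := by
    clear h3 h4
    induction l with
    | zero => exact ⟨0, by simp⟩
    | succ l ih =>
      obtain ⟨a, ha⟩ := ih
      refine ⟨(-1 : ℝ) ^ l • (restRsq i j ^ l) h + planeRsq i j a, ?_⟩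
      rw [pow_succ', Module.End.mul_apply, ha, map_add, map_smul, planeRsq_Rsq, map_add, map_smul,
        pow_succ' (restRsq i j), Module.End.mul_apply (restRsq i j), restRsq, LinearMap.sub_apply]
      module
  obtain ⟨a, ha⟩ := key
  rw [SetLike.mem_coe, ha]
  refine add_mem (planeHarm_le_radialBelow (p := q) (by omega) (Submodule.smul_mem _ _ ?_))
    (range_le_radialBelow ⟨a, rfl⟩)
  simpa using restRsq_pow_mem_planeHarm hij h4 l

/-! ### Submodules -/

theorem L_mem {W : Submodule (Uosp m n) (SuperPoly m n)} {f : SuperPoly m n} (hf : f ∈ W)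
    (a b : SuperIdx m n) : L a b f ∈ W :=
  W.smul_mem (⟨L a b, Algebra.subset_adjoin (Submodule.subset_span ⟨(a, b), rfl⟩)⟩ : Uosp m n) hf

/-- An `𝔬𝔰𝔭(m|2n)`-submodule as a real subspace. -/
def realSubspace (W : Submodule (Uosp m n) (SuperPoly m n)) : Submodule ℝ (SuperPoly m n) where
  carrier := W
  add_mem' := W.add_mem
  zero_mem' := W.zero_mem
  smul_mem' c _ hf := W.smul_mem (⟨algebraMap ℝ _ c, Subalgebra.algebraMap_mem _ c⟩ : Uosp m n) hf

theorem mem_polyDeg {k : ℤ} {f : SuperPoly m n} :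
    f ∈ polyDeg m n k ↔ euler m n f = (k : ℝ) • f := by
  rw [Int.cast_smul_eq_zsmul]; rfl

theorem mem_harmonic {k : ℤ} {f : SuperPoly m n} :
    f ∈ harmonic m n k ↔ euler m n f = (k : ℝ) • f ∧ laplacian m n f = 0 := by
  rw [← mem_polyDeg]; rfl

theorem L_inl_left (a : SuperIdx m n) (f : SuperPoly m n) : L (Sum.inl i) a f =
    mulX (Sum.inl i) (dUpper a f) - mulX a (dX (Sum.inl i) f) := by
  simp [L, sgn, dUpper_inl]

theorem L_inl_right (a : SuperIdx m n) (f : SuperPoly m n) : L a (Sum.inl i) f =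
    mulX a (dX (Sum.inl i) f) - mulX (Sum.inl i) (dUpper a f) := by
  rcases a with a | a <;> simp [L, sgn, dUpper_inl]

theorem weightCut_mem_range (hij : i ≠ j) {q : ℕ} {k : ℝ} {f : SuperPoly m n}
    (hf : f ∈ radialBelow n i j k q) : weightCut n i j q f ∈ LinearMap.range (mulRsq m n) := by
  refine radialBelow_le (S := (LinearMap.range (mulRsq m n)).comap (weightCut n i j q)) ?_ ?_ hf
  · intro p hp f hf
    rw [Submodule.mem_comap, weightCut_eq_zero hp (rotationSq_planeHarm hij hf)]
    exact zero_mem _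
  · rintro _ ⟨f, rfl⟩
    exact ⟨_, (weightCut_Rsq q f).symm⟩

theorem planeHarm_neg_one (hij : i ≠ j) {k : ℝ} {f : SuperPoly m n}
    (hf : f ∈ planeHarm n i j (-1) k) : f = 0 :=
  eq_zero_of_planeEuler_apply hij hf.1 fun t h => by
    have : (0 : ℝ) ≤ t := t.cast_nonneg
    linarith

theorem pred_mem_radialBelow (hij : i ≠ j) {p : ℕ} {k : ℝ} {f : SuperPoly m n}
    (hf : f ∈ planeHarm n i j (p - 1) k) : f ∈ radialBelow n i j k p := by
  rcases p with _ | p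
  · rw [Nat.cast_zero, zero_sub] at hf
    rw [planeHarm_neg_one hij hf]
    exact zero_mem _
  · refine planeHarm_le_radialBelow p.lt_succ_self ?_
    simpa using hf

/-- The raising part of the action of `L_{is}` on a plane harmonic. -/
theorem exists_L_eq (hij : i ≠ j) {s : SuperIdx m n} (hi : s ≠ Sum.inl i) (hj : s ≠ Sum.inl j)
    {p : ℕ} {k : ℝ} {f : SuperPoly m n} (hf : f ∈ planeHarm n i j p k) :
    ∃ g ∈ planeHarm n i j (p + 1 : ℕ) k, (∃ c : ℝ, c ≠ 0 ∧ dX (Sum.inl i) g = c • dUpper s f) ∧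
      ∃ d ∈ radialBelow n i j k p, L (Sum.inl i) s f = g + d := by
  have hu := dUpper_mem_planeHarm hi hj hf
  obtain ⟨g, hg, c, d, hc, h1, h2⟩ := exists_raise hij hu
  rw [sub_add_cancel] at hg
  have hdu := dX_left_mem_planeHarm hij hu
  have hr := restRsq_mem_planeHarm hij hdu
  rw [show k - 1 - 1 + 2 = k by ring] at hr
  have hx := mulX_mem_planeHarm hi hj (dX_left_mem_planeHarm hij hf)
  rw [sub_add_cancel] at hx
  refine ⟨g, hg, ⟨c, hc, h2⟩, d • mulRsq m n (dX (Sum.inl i) (dUpper s f)) -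
    d • restRsq i j (dX (Sum.inl i) (dUpper s f)) - mulX s (dX (Sum.inl i) f), ?_, ?_⟩
  · refine sub_mem (sub_mem (Submodule.smul_mem _ _ (range_le_radialBelow ⟨_, rfl⟩))
      (Submodule.smul_mem _ _ (pred_mem_radialBelow hij hr))) (pred_mem_radialBelow hij hx)
  · rw [L_inl_left, h1, restRsq, LinearMap.sub_apply]
    module

theorem L_mem_radialBelow (hij : i ≠ j) {s : SuperIdx m n} (hi : s ≠ Sum.inl i)
    (hj : s ≠ Sum.inl j) {q : ℕ} {k : ℝ} {f : SuperPoly m n} (hf : f ∈ radialBelow n i j k q) :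
    L (Sum.inl i) s f ∈ radialBelow n i j k (q + 1) := by
  refine radialBelow_le (S := (radialBelow n i j k (q + 1)).comap (L (Sum.inl i) s)) ?_ ?_ hf
  · intro p hp f hf
    obtain ⟨g, hg, -, d, hd, h⟩ := exists_L_eq hij hi hj hf
    rw [Submodule.mem_comap, h]
    refine add_mem (planeHarm_le_radialBelow (by omega) hg) (radialBelow_le (fun r hr =>
      planeHarm_le_radialBelow (by omega)) range_le_radialBelow hd)
  · rintro _ ⟨f, rfl⟩
    exact range_le_radialBelow
      ⟨L (Sum.inl i) s f, LinearMap.congr_fun (commute_Rsq_L (Sum.inl i) s).eq f⟩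

theorem eq_zero_of_dUpper_eq_zero (hij : i ≠ j) {p k : ℝ} (hpk : p ≠ k) {f : SuperPoly m n}
    (hf : f ∈ planeHarm n i j p k)
    (h : ∀ s : SuperIdx m n, s ≠ Sum.inl i → s ≠ Sum.inl j → dUpper s f = 0) : f = 0 := by
  have h0 : ∀ s : SuperIdx m n, s ≠ Sum.inl i → s ≠ Sum.inl j → dX s f = 0 := by
    rintro (s | s) hi hj
    · rw [← dUpper_inl]; exact h _ hi hj
    · obtain ⟨t, c, ht⟩ := exists_dX_eq (m := m) s
      rw [ht, LinearMap.smul_apply, h _ (by simp) (by simp), smul_zero]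
  have hE := euler_eq_planeEuler_add hij f
  rw [Finset.sum_eq_zero, add_zero, hf.1, hf.2.1] at hE
  · have : (k - p) • f = 0 := by rw [sub_smul, hE, sub_self]
    exact (smul_eq_zero.1 this).resolve_left (sub_ne_zero.2 hpk.symm)
  · intro s hs
    simp only [Finset.mem_sdiff, Finset.mem_univ, true_and, Finset.mem_insert,
      Finset.mem_singleton, not_or] at hs
    rw [h0 s hs.1 hs.2, map_zero]

/-- A submodule of `𝒫_k` that meets the plane harmonics of degree `k` trivially consists of multiples
of `R²`. -/
theorem le_range_Rsq (hij : i ≠ j) {k : ℕ} {W : Submodule (Uosp m n) (SuperPoly m n)}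
    (hW : W ≤ polyDeg m n k) (h0 : ∀ f ∈ W, f ∈ planeHarm n i j k k → f = 0) :
    realSubspace W ≤ LinearMap.range (mulRsq m n) := by
  have hE : ∀ f ∈ W, euler m n f = (k : ℝ) • f := fun f hf => by
    simpa using mem_polyDeg.1 (hW hf)
  have step : ∀ q ≤ k, realSubspace W ≤ radialBelow n i j k (q + 1) →
      realSubspace W ≤ radialBelow n i j k q := by
    intro q hq hWq f hf
    obtain ⟨g, hg, d, hd, rfl⟩ := exists_of_mem_radialBelow_succ (hWq hf)
    suffices hg0 : g = 0 by rwa [hg0, zero_add]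
    obtain hq | rfl := hq.lt_or_eq
    · refine eq_zero_of_dUpper_eq_zero hij (by exact_mod_cast hq.ne) hg fun s hi hj => ?_
      obtain ⟨g', hg', ⟨c, hc, hcg⟩, d', hd', hL⟩ := exists_L_eq hij hi hj hg
      have h1 := hWq (L_mem hf (Sum.inl i) s)
      have h2 : g' ∈ radialBelow n i j k (q + 1) := by
        have h3 := sub_mem h1 (add_mem (radialBelow_le (fun r hr =>
          planeHarm_le_radialBelow (by omega)) range_le_radialBelow hd')
          (L_mem_radialBelow hij hi hj hd))
        rw [map_add, hL] at h3
        convert h3 using 1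
        abel
      have h4 := eq_zero_of_mem_radialBelow hij hg' h2
      rw [h4, map_zero] at hcg
      exact (smul_eq_zero.1 hcg.symm).resolve_left hc
    · obtain ⟨c, hc, hcut⟩ := weightCut_apply (n := n) hij q q
      have h1 : weightCut n i j q (g + d) = 0 :=
        h0 _ (W.smul_mem (⟨_, weightCut_mem_Uosp q⟩ : Uosp m n) hf) (weightCut_mem hij (hE _ hf))
      rw [map_add, hcut g hg] at h1
      refine eq_zero_of_mem_range_Rsq hij hg ?_
      have h2 := Submodule.smul_mem _ (-c⁻¹) (weightCut_mem_range hij hd)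
      rw [eq_neg_of_add_eq_zero_right h1] at h2
      simpa [smul_smul, inv_mul_cancel₀ hc] using h2
  have all : ∀ d q, q + d = k + 1 → realSubspace W ≤ radialBelow n i j k q := by
    intro d
    induction d with
    | zero =>
      rintro q rfl f hf
      exact mem_radialBelow hij (hE f hf)
    | succ d ih => exact fun q hq => step q (by omega) (ih (q + 1) (by omega))
  refine (all (k + 1) 0 (by omega)).trans (radialBelow_le (fun p hp => by omega) le_rfl)

/-! ### Generation of the harmonics by plane harmonics -/

/-- The superpolynomials of degree `k` whose degree outside the plane is `< e`. -/
def restDegBelow (n : ℕ) (i j : Fin m) (k : ℝ) (e : ℕ) : Submodule ℝ (SuperPoly m n) :=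
  ⨆ t ∈ Finset.range e, (planeEuler i j).eigenspace (k - t) ⊓ (euler m n).eigenspace k

theorem mem_restDegBelow {k : ℝ} {e t : ℕ} (ht : t < e) {f : SuperPoly m n}
    (h1 : planeEuler i j f = (k - t) • f) (h2 : euler m n f = k • f) :
    f ∈ restDegBelow n i j k e :=
  le_iSup₂_of_le (f := fun (t : ℕ) (_ : t ∈ Finset.range e) =>
    (planeEuler (n := n) i j).eigenspace (k - t) ⊓ (euler m n).eigenspace k) t
    (Finset.mem_range.2 ht) le_rfl
    ⟨Module.End.mem_eigenspace_iff.2 h1, Module.End.mem_eigenspace_iff.2 h2⟩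

theorem restDegBelow_le {k : ℝ} {e : ℕ} {S : Submodule ℝ (SuperPoly m n)}
    (h : ∀ t < e, ∀ f, planeEuler i j f = (k - t) • f → euler m n f = k • f → f ∈ S) :
    restDegBelow n i j k e ≤ S :=
  iSup₂_le fun t ht f hf => h t (Finset.mem_range.1 ht) f (Module.End.mem_eigenspace_iff.1 hf.1)
    (Module.End.mem_eigenspace_iff.1 hf.2)

theorem exists_of_mem_restDegBelow_succ {k : ℝ} {e : ℕ} {f : SuperPoly m n}
    (hf : f ∈ restDegBelow n i j k (e + 1)) :
    ∃ g, planeEuler i j g = (k - e) • g ∧ euler m n g = k • g ∧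
      ∃ d ∈ restDegBelow n i j k e, f = g + d := by
  rw [restDegBelow, Finset.range_add_one, Finset.iSup_insert] at hf
  obtain ⟨g, hg, d, hd, rfl⟩ := Submodule.mem_sup.1 hf
  exact ⟨g, Module.End.mem_eigenspace_iff.1 hg.1, Module.End.mem_eigenspace_iff.1 hg.2, d, hd, rfl⟩

theorem eq_zero_of_lt_planeDeg (hij : i ≠ j) {k p : ℕ} (hkp : k < p) {f : SuperPoly m n}
    (h1 : planeEuler i j f = (p : ℝ) • f) (h2 : euler m n f = (k : ℝ) • f) : f = 0 :=
  Module.End.eq_zero_of_mem_eigenBelow (N := k + 1) (c := fun t => (t : ℝ)) h1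
    (bidegree_induction hij _ (fun p g hp hg _ => Module.End.mem_eigenBelow (by omega) hg) h2)
    fun t ht => by exact_mod_cast (show t ≠ p by omega)

theorem planeEuler_dUpper_of_ne {a : SuperIdx m n} (hi : a ≠ Sum.inl i) (hj : a ≠ Sum.inl j)
    (f : SuperPoly m n) : planeEuler i j (dUpper a f) = dUpper a (planeEuler i j f) := by
  rcases a with a | a
  · rw [dUpper_inl, planeEuler_dX_of_ne hi hj]
  · obtain ⟨t, c, -, h⟩ := exists_dUpper_eq (m := m) a
    rw [h, LinearMap.smul_apply, map_smul, planeEuler_dX_of_ne (by simp) (by simp),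
      LinearMap.smul_apply]

theorem euler_dUpper (a : SuperIdx m n) (f : SuperPoly m n) :
    euler m n (dUpper a f) = dUpper a (euler m n f) - dUpper a f :=
  eq_sub_of_add_eq (LinearMap.congr_fun (dUpper_mul_euler a) f).symm

theorem mulX_dUpper_mem_restDegBelow (hij : i ≠ j) {s : SuperIdx m n} (hi : s ≠ Sum.inl i)
    (hj : s ≠ Sum.inl j) {k t e : ℕ} (ht : t ≤ e) {f : SuperPoly m n}
    (h1 : planeEuler i j f = (k - t : ℝ) • f) (h2 : euler m n f = (k : ℝ) • f) :
    mulX (Sum.inl i) (dUpper s f) ∈ restDegBelow n i j k e := by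
  have h3 : planeEuler i j (mulX (Sum.inl i) (dUpper s f)) =
      (k - t + 1 : ℝ) • mulX (Sum.inl i) (dUpper s f) := by
    rw [planeEuler_mulX_left hij, planeEuler_dUpper_of_ne hi hj, h1, map_smul, map_smul]; module
  have h4 : euler m n (mulX (Sum.inl i) (dUpper s f)) =
      (k : ℝ) • mulX (Sum.inl i) (dUpper s f) := by
    rw [euler_mulX, euler_dUpper, h2, map_smul, map_sub, map_smul]; module
  rcases t with _ | t
  · rw [Nat.cast_zero, sub_zero, ← Nat.cast_succ] at h3
    rw [eq_zero_of_lt_planeDeg hij k.lt_succ_self h3 h4]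
    exact zero_mem _
  · refine mem_restDegBelow (t := t) (by omega) ?_ h4
    rw [h3]; push_cast; module

theorem L_mem_restDegBelow (hij : i ≠ j) {s : SuperIdx m n} (hi : s ≠ Sum.inl i)
    (hj : s ≠ Sum.inl j) {k e : ℕ} {f : SuperPoly m n} (hf : f ∈ restDegBelow n i j k e) :
    L s (Sum.inl i) f ∈ restDegBelow n i j k (e + 1) := by
  refine restDegBelow_le (S := (restDegBelow n i j k (e + 1)).comap (L s (Sum.inl i)))
    (fun t ht g h1 h2 => ?_) hf
  rw [Submodule.mem_comap, L_inl_right]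
  refine sub_mem (mem_restDegBelow (t := t + 1) (by omega) ?_ ?_)
    (mulX_dUpper_mem_restDegBelow hij hi hj (by omega) h1 h2)
  · rw [planeEuler_mulX_of_ne hi hj, planeEuler_dX_left hij, h1, map_smul, map_sub, map_smul]
    push_cast; module
  · rw [euler_mulX, euler_dX, h2, map_smul, map_sub, map_smul]; module

/-- Every plane harmonic of degree `k` is the leading part of an element of the submodule generated
by those of plane degree `k`. -/
theorem exists_sub_mem_restDegBelow (hij : i ≠ j) {k : ℕ}
    {V : Submodule (Uosp m n) (SuperPoly m n)} (hV : planeHarm n i j k k ≤ realSubspace V) (e : ℕ) :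
    ∀ p : ℕ, p + e = k → ∀ h ∈ planeHarm n i j p k, ∃ v ∈ realSubspace V,
      v - h ∈ restDegBelow n i j k e := by
  induction e with
  | zero =>
    rintro p rfl h hh
    exact ⟨h, hV hh, by rw [sub_self]; exact zero_mem _⟩
  | succ e ih =>
    intro p hp h hh
    have key : ∀ s ∈ (Finset.univ \ {Sum.inl i, Sum.inl j} : Finset (SuperIdx m n)),
        ∃ v ∈ realSubspace V, v - mulX s (dX s h) ∈ restDegBelow n i j k (e + 1) := by
      intro s hs
      simp only [Finset.mem_sdiff, Finset.mem_univ, true_and, Finset.mem_insert,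
        Finset.mem_singleton, not_or] at hs
      obtain ⟨g, hg, c, -, hc, -, hcg⟩ := exists_raise hij (dX_mem_planeHarm hs.1 hs.2 hh)
      rw [sub_add_cancel] at hg
      obtain ⟨v, hv, hvg⟩ := ih (p + 1) (by omega) g hg
      refine ⟨c⁻¹ • L s (Sum.inl i) v, Submodule.smul_mem _ _ (L_mem hv _ _), ?_⟩
      have h1 := L_mem_restDegBelow hij hs.1 hs.2 hvg
      have h2 : mulX (Sum.inl i) (dUpper s g) ∈ restDegBelow n i j k (e + 1) := by
        refine mulX_dUpper_mem_restDegBelow hij hs.1 hs.2 (t := e) (by omega) ?_ hg.2.1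
        rw [hg.1, ← hp]; push_cast; module
      have h3 := Submodule.smul_mem _ c⁻¹ (sub_mem h1 h2)
      rw [map_sub, L_inl_right s g, hcg, map_smul] at h3
      convert h3 using 1
      match_scalars <;> field_simp
      ring
    choose! v hv hvs using key
    have hc : (e + 1 : ℝ) ≠ 0 := by positivity
    refine ⟨(e + 1 : ℝ)⁻¹ • ∑ s ∈ Finset.univ \ {Sum.inl i, Sum.inl j}, v s,
      Submodule.smul_mem _ _ (sum_mem hv), ?_⟩
    have h1 := Submodule.smul_mem _ (e + 1 : ℝ)⁻¹ (sum_mem hvs)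
    have hE := euler_eq_planeEuler_add hij h
    rw [Finset.sum_sub_distrib, ← sub_eq_of_eq_add' hE, hh.1, hh.2.1, ← hp] at h1
    rw [← hp]
    convert h1 using 1
    push_cast
    match_scalars <;> field_simp
    ring

theorem planeEuler_restLap (hij : i ≠ j) {p : ℝ} {f : SuperPoly m n}
    (hf : planeEuler i j f = p • f) : planeEuler i j (laplacian m n f - planeLap i j f) =
      p • (laplacian m n f - planeLap i j f) := by
  rw [map_sub, planeEuler_laplacian, planeEuler_planeLap hij, hf, map_smul, map_smul]; module

theorem planeLap_leading_eq_zero (hij : i ≠ j) {k : ℝ} {e : ℕ} {g d : SuperPoly m n}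
    (hg : planeEuler i j g = (k - e) • g) (hd : d ∈ restDegBelow n i j k e)
    (h : laplacian m n (g + d) = 0) : planeLap i j g = 0 := by
  set B := (planeEuler (n := n) i j).eigenBelow (fun t => k - t) (e + 2) with hB
  have hmem : ∀ t < e + 2, ∀ f : SuperPoly m n, planeEuler i j f = (k - t) • f → f ∈ B :=
    fun t ht f hf => Module.End.mem_eigenBelow (c := fun t : ℕ => k - t) ht hf
  have h1 : laplacian m n g - planeLap i j g ∈ B :=
    hmem e (by omega) _ (planeEuler_restLap hij hg)
  have h2 : laplacian m n d ∈ B := by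
    refine restDegBelow_le (S := B.comap (laplacian m n)) (fun t ht f hf _ => ?_) hd
    rw [Submodule.mem_comap, ← sub_add_cancel (laplacian m n f) (planeLap i j f)]
    refine add_mem (hmem t (by omega) _ (planeEuler_restLap hij hf)) (hmem (t + 2) (by omega) _ ?_)
    rw [planeEuler_planeLap_apply hij hf]; push_cast; module
  refine Module.End.eq_zero_of_mem_eigenBelow (planeEuler_planeLap_apply hij hg) (N := e + 2)
    (c := fun t => k - t) ?_ fun t ht h' => ?_
  · have h3 := neg_mem (add_mem h1 h2)
    rw [map_add] at h
    convert h3 using 1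
    rw [sub_add_eq_add_sub, h]; abel
  · have : (t : ℝ) < e + 2 := by exact_mod_cast ht
    linarith

/-- The plane harmonics of degree `k` generate the module of harmonics of degree `k`. -/
theorem harmonic_le_of_planeHarm_le (hij : i ≠ j) {k : ℕ}
    {V : Submodule (Uosp m n) (SuperPoly m n)} (hVH : V ≤ harmonic m n k)
    (hV : planeHarm n i j k k ≤ realSubspace V) : harmonic m n k ≤ V := by
  have key : ∀ e ≤ k + 1, ∀ f ∈ harmonic m n k, f ∈ restDegBelow n i j k e → f ∈ V := by
    intro e
    induction e with
    | zero =>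
      intro _ f _ hf
      rw [restDegBelow] at hf
      have : f = 0 := by simpa using hf
      rw [this]; exact zero_mem _
    | succ e ih =>
      intro he f hfH hf
      obtain ⟨g, hg1, hg2, d, hd, rfl⟩ := exists_of_mem_restDegBelow_succ hf
      have hL := planeLap_leading_eq_zero hij hg1 hd (mem_harmonic.1 hfH).2
      obtain ⟨p, hp⟩ := Nat.exists_eq_add_of_le' (show e ≤ k by omega)
      have hg : g ∈ planeHarm n i j p k := by
        refine ⟨?_, hg2, hL⟩
        rw [hg1, hp]; push_cast; module
      obtain ⟨v, hv, hvg⟩ := exists_sub_mem_restDegBelow hij hV e p hp.symm g hg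
      have h1 := ih (by omega) (g + d - v) (sub_mem hfH (hVH hv)) (by
        have := sub_mem hd hvg
        convert this using 1
        abel)
      have := V.add_mem h1 hv
      rwa [sub_add_cancel] at this
  intro f hf
  have hE : euler m n f = (k : ℝ) • f := by simpa using (mem_harmonic.1 hf).1
  refine key (k + 1) le_rfl f hf (bidegree_induction hij _ (fun p g hp h1 h2 => ?_) hE)
  refine mem_restDegBelow (t := k - p) (by omega) ?_ h2
  rw [h1, Nat.cast_sub hp, sub_sub_cancel]

/-! ### Irreducibility of the plane harmonics under rotation -/

theorem tmul_one_ne_zero : (tmul 1 1 : SuperPoly m n) ≠ 0 := by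
  intro h
  have h : (1 ⊗ₜ[ℝ] 1 : MvPolynomial (Fin m) ℝ ⊗[ℝ] ExteriorAlgebra ℝ (Fin 2 × Fin n → ℝ)) = 0 := h
  have h1 := congrArg (TensorProduct.lift ((LinearMap.mul ℝ ℝ).compl₁₂
    (MvPolynomial.aeval (R := ℝ) (fun _ : Fin m => (0 : ℝ))).toLinearMap
    (ExteriorAlgebra.algebraMapInv (R := ℝ) (M := Fin 2 × Fin n → ℝ)).toLinearMap)) h
  rw [map_zero] at h1
  refine one_ne_zero (α := ℝ) ?_
  rw [← h1]
  exact (by simp : (1 : ℝ) = MvPolynomial.aeval (R := ℝ) (fun _ : Fin m => (0 : ℝ)) 1 *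
    ExteriorAlgebra.algebraMapInv (R := ℝ) (M := Fin 2 × Fin n → ℝ) 1)

theorem tmul_one_mem_planeHarm : tmul 1 1 ∈ planeHarm n i j 0 0 :=
  ⟨by simp [planeEuler_apply, dX_tmul_one], by simp [euler, dX_tmul_one],
    by simp [planeLap_apply, dX_tmul_one]⟩

theorem exists_planeHarm_ne_zero (hij : i ≠ j) (p : ℕ) : ∃ h ∈ planeHarm n i j p p, h ≠ 0 := by
  induction p with
  | zero => exact ⟨tmul 1 1, by simpa using tmul_one_mem_planeHarm, tmul_one_ne_zero⟩
  | succ p ih =>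
    obtain ⟨h, hh, h0⟩ := ih
    obtain ⟨g, hg, c, -, hc, -, hcg⟩ := exists_raise hij hh
    refine ⟨g, by simpa using hg, fun hg0 => ?_⟩
    rw [hg0, map_zero] at hcg
    exact (smul_eq_zero.1 hcg.symm).elim hc h0

theorem exists_smul_one_of_euler_eq_zero {f : SuperPoly m n} (hf : euler m n f = 0) :
    ∃ c : ℝ, f = c • tmul 1 1 := by
  have htop : (ℝ ∙ (tmul 1 1 : SuperPoly m n)) ⊔
      ⨆ t : ℕ, (euler m n).eigenspace ((t + 1 : ℕ) : ℝ) = ⊤ := by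
    refine eq_top_of_mulX_mem _
      (Submodule.mem_sup_left (Submodule.mem_span_singleton_self _)) fun a g hg => ?_
    refine Submodule.mem_sup_right ?_
    obtain ⟨x, hx, y, hy, rfl⟩ := Submodule.mem_sup.1 hg
    rw [map_add]
    refine add_mem (Submodule.mem_iSup_of_mem 0 (Module.End.mem_eigenspace_iff.2 ?_)) ?_
    · obtain ⟨c, rfl⟩ := Submodule.mem_span_singleton.1 hx
      have : euler m n (tmul 1 1) = 0 := by simp [euler, dX_tmul_one]
      rw [euler_mulX, map_smul, this]; simp
    · clear hg hx
      induction hy using Submodule.iSup_induction' with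
      | mem t z hz =>
        refine Submodule.mem_iSup_of_mem (t + 1) (Module.End.mem_eigenspace_iff.2 ?_)
        rw [euler_mulX, Module.End.mem_eigenspace_iff.1 hz, map_smul]; push_cast; module
      | zero => rw [map_zero]; exact zero_mem _
      | add z w _ _ hz hw => rw [map_add]; exact add_mem hz hw
  obtain ⟨x, hx, y, hy, rfl⟩ := Submodule.mem_sup.1 (htop ▸ Submodule.mem_top (x := f))
  obtain ⟨c, rfl⟩ := Submodule.mem_span_singleton.1 hx
  have h1 : euler m n (tmul 1 1) = 0 := by simp [euler, dX_tmul_one]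
  rw [map_add, map_smul, h1, smul_zero, zero_add] at hf
  obtain ⟨N, hN⟩ := Module.End.exists_mem_eigenBelow (c := fun t => ((t + 1 : ℕ) : ℝ)) hy
  have h2 : y = 0 := Module.End.eq_zero_of_mem_eigenBelow (μ := 0) (by rw [hf, zero_smul]) hN
    fun t _ => by positivity
  exact ⟨c, by rw [h2, add_zero]⟩

theorem eq_zero_of_dX_left_eq_zero (hij : i ≠ j) {p k : ℝ} (h0 : p ≠ 0) (h1 : p ≠ 1)
    {f : SuperPoly m n} (hf : f ∈ planeHarm n i j p k) (hd : dX (Sum.inl i) f = 0) : f = 0 := by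
  have h2 := dX_right_sq hf
  rw [hd, map_zero, neg_zero] at h2
  have h3 := (dX_right_mem_planeHarm hij hf).1
  rw [planeEuler_apply, h2, ← dX_inl_comm i (Sum.inl j), hd] at h3
  simp only [map_zero, add_zero] at h3
  have h4 := (smul_eq_zero.1 h3.symm).resolve_left (sub_ne_zero.2 h1)
  have h5 := hf.1
  rw [planeEuler_apply, hd, h4] at h5
  simp only [map_zero, add_zero] at h5
  exact (smul_eq_zero.1 h5.symm).resolve_left h0

theorem exists_planeHarm_span (hij : i ≠ j) (p : ℕ) : ∃ u ∈ planeHarm n i j (p + 1 : ℕ) (p + 1 : ℕ),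
    ∃ v ∈ planeHarm n i j (p + 1 : ℕ) (p + 1 : ℕ), ∀ h ∈ planeHarm n i j (p + 1 : ℕ) (p + 1 : ℕ),
      ∃ a b : ℝ, h = a • u + b • v := by
  induction p with
  | zero =>
    have hx : ∀ i j : Fin m, i ≠ j →
        mulX (Sum.inl i) (tmul 1 1) ∈ planeHarm n i j (0 + 1 : ℕ) (0 + 1 : ℕ) := fun i j hij => by
      obtain ⟨h1, h2, h3⟩ := tmul_one_mem_planeHarm (n := n) (i := i) (j := j)
      refine ⟨?_, ?_, ?_⟩
      · rw [planeEuler_mulX_left hij, h1]; simp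
      · rw [euler_mulX, h2]; simp
      · rw [planeLap_mulX_left hij, h3, dX_tmul_one]; simp
    refine ⟨_, hx i j hij, mulX (Sum.inl j) (tmul 1 1), ?_, fun h hh => ?_⟩
    · rw [planeHarm_comm]; exact hx j i hij.symm
    · have h1 := (dX_left_mem_planeHarm hij hh).2.1
      have h2 := (dX_right_mem_planeHarm hij hh).2.1
      have h3 := hh.1
      rw [zero_add, Nat.cast_one, sub_self, zero_smul] at h1 h2
      rw [zero_add, Nat.cast_one, one_smul, planeEuler_apply] at h3
      obtain ⟨a, ha⟩ := exists_smul_one_of_euler_eq_zero h1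
      obtain ⟨b, hb⟩ := exists_smul_one_of_euler_eq_zero h2
      exact ⟨a, b, by rw [← h3, ha, hb, map_smul, map_smul]⟩
  | succ p ih =>
    obtain ⟨u, hu, v, hv, huv⟩ := ih
    obtain ⟨u', hu', c, -, hc, -, hcu⟩ := exists_raise hij hu
    obtain ⟨v', hv', d, -, hd, -, hdv⟩ := exists_raise hij hv
    rw [← Nat.cast_succ] at hu' hv'
    refine ⟨u', hu', v', hv', fun h hh => ?_⟩
    have h1 := dX_left_mem_planeHarm hij hh
    rw [Nat.cast_succ (p + 1), add_sub_cancel_right] at h1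
    obtain ⟨a, b, hab⟩ := huv _ h1
    refine ⟨a * c⁻¹, b * d⁻¹, sub_eq_zero.1 (eq_zero_of_dX_left_eq_zero hij ?_ ?_ (sub_mem hh
      (add_mem (Submodule.smul_mem _ _ hu') (Submodule.smul_mem _ _ hv'))) ?_)⟩
    · positivity
    · exact_mod_cast (show p + 1 + 1 ≠ 1 by omega)
    · rw [map_sub, map_add, map_smul, map_smul, hcu, hdv, hab]
      match_scalars <;> field_simp <;> ring

theorem planeHarm_eq_zero_of_smul_eq (hij : i ≠ j) {p k s t : ℝ} (hp : p ≠ 0) {f : SuperPoly m n}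
    (hf : f ∈ planeHarm n i j p k) (h0 : f ≠ 0) (h : s • f = t • rotation i j f) :
    s = 0 ∧ t = 0 := by
  have h1 := congrArg (fun x => t • rotation i j x) h
  simp only [map_smul, rotation_sq hij hf] at h1
  have h2 : (s ^ 2 + t ^ 2 * p ^ 2) • f = 0 := by
    linear_combination (norm := module) s • h + (1 : ℝ) • h1
  have h3 := (smul_eq_zero.1 h2).resolve_right h0
  have hp2 : 0 < p ^ 2 := by positivity
  have hs : s ^ 2 = 0 := by nlinarith [sq_nonneg s, mul_nonneg (sq_nonneg t) hp2.le]
  have ht : t ^ 2 * p ^ 2 = 0 := by rw [hs, zero_add] at h3; exact h3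
  exact ⟨pow_eq_zero_iff two_ne_zero |>.1 hs,
    pow_eq_zero_iff two_ne_zero |>.1 ((mul_eq_zero.1 ht).resolve_right hp2.ne')⟩

/-- Over the reals the plane harmonics of positive degree form an irreducible module for the rotations
of the plane. -/
theorem planeHarm_le_of_mem (hij : i ≠ j) {p : ℕ} (hp : p ≠ 0)
    {W : Submodule (Uosp m n) (SuperPoly m n)} {f : SuperPoly m n} (hf : f ∈ W)
    (hfp : f ∈ planeHarm n i j p p) (h0 : f ≠ 0) : planeHarm n i j p p ≤ realSubspace W := by
  obtain ⟨p, rfl⟩ := Nat.exists_eq_succ_of_ne_zero hp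
  obtain ⟨u, hu, v, hv, huv⟩ := exists_planeHarm_span (n := n) hij p
  obtain ⟨a, b, hab⟩ := huv f hfp
  obtain ⟨c, d, hcd⟩ := huv _ (rotation_mem_planeHarm hij hfp)
  have hJ : rotation i j f ∈ realSubspace W := L_mem hf _ _
  have hf' : f ∈ realSubspace W := hf
  have hp' : ((p + 1 : ℕ) : ℝ) ≠ 0 := by positivity
  have hu1 : (a * d - b * c) • u = d • f - b • rotation i j f := by
    rw [hcd, hab]; module
  have hv1 : (a * d - b * c) • v = a • rotation i j f - c • f := by
    rw [hcd, hab]; module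
  have hD : a * d - b * c ≠ 0 := fun hD => by
    rw [hD, zero_smul] at hu1 hv1
    obtain ⟨-, hb⟩ := planeHarm_eq_zero_of_smul_eq hij hp' hfp h0 (sub_eq_zero.1 hu1.symm)
    obtain ⟨-, ha⟩ := planeHarm_eq_zero_of_smul_eq hij hp' hfp h0 (sub_eq_zero.1 hv1.symm).symm
    exact h0 (by rw [hab, ha, hb]; simp)
  have hinv : ∀ x : SuperPoly m n, (a * d - b * c) • x ∈ realSubspace W → x ∈ realSubspace W :=
    fun x hx => by
      have := Submodule.smul_mem _ (a * d - b * c)⁻¹ hx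
      rwa [smul_smul, inv_mul_cancel₀ hD, one_smul] at this
  have huW : u ∈ realSubspace W := hinv u (by
    rw [hu1]; exact sub_mem (Submodule.smul_mem _ _ hf') (Submodule.smul_mem _ _ hJ))
  have hvW : v ∈ realSubspace W := hinv v (by
    rw [hv1]; exact sub_mem (Submodule.smul_mem _ _ hJ) (Submodule.smul_mem _ _ hf'))
  intro h hh
  obtain ⟨s, t, rfl⟩ := huv h hh
  exact add_mem (Submodule.smul_mem _ _ huW) (Submodule.smul_mem _ _ hvW)

theorem planeHarm_le_harmonic (hij : i ≠ j) {k : ℕ} (hk : 2 ≤ k) {f : SuperPoly m n}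
    (hf : f ∈ planeHarm n i j k k) : f ∈ harmonic m n k := by
  obtain ⟨h1, h2, h3⟩ := hf
  refine mem_harmonic.2 ⟨by simpa using h2, ?_⟩
  have hP := planeEuler_restLap hij h1
  rw [h3, sub_zero] at hP
  have hE : euler m n (laplacian m n f) = (k - 2 : ℝ) • laplacian m n f := by
    rw [euler_laplacian, h2, map_smul]; module
  obtain ⟨l, rfl⟩ := Nat.exists_eq_add_of_le' hk
  refine eq_zero_of_lt_planeDeg hij (k := l) (p := l + 2) (by omega) hP ?_
  rw [hE]; push_cast; module

/-! ### Multiples of `R²` that are harmonic -/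

theorem euler_Rsq_pow {d : ℝ} {f : SuperPoly m n} (hf : euler m n f = d • f) (t : ℕ) :
    euler m n ((mulRsq m n ^ t) f) = (d + 2 * t) • (mulRsq m n ^ t) f := by
  induction t with
  | zero => simpa using hf
  | succ t ih =>
    rw [pow_succ', Module.End.mul_apply, euler_Rsq, ih, map_smul]
    push_cast; module

theorem laplacian_Rsq_pow {d : ℝ} {f : SuperPoly m n} (hf : euler m n f = d • f) (t : ℕ) :
    laplacian m n ((mulRsq m n ^ (t + 1)) f) = (mulRsq m n ^ (t + 1)) (laplacian m n f) +
      (2 * (t + 1) * (2 * d + superDim m n + 2 * t) : ℝ) • (mulRsq m n ^ t) f := by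
  induction t with
  | zero =>
    rw [zero_add, pow_one, laplacian_Rsq, hf, pow_zero, Module.End.one_apply]
    push_cast; module
  | succ t ih =>
    rw [pow_succ', Module.End.mul_apply, laplacian_Rsq, ih, euler_Rsq_pow hf, map_add, map_smul,
      ← Module.End.mul_apply (mulRsq m n) (mulRsq m n ^ (t + 1)), ← pow_succ',
      ← Module.End.mul_apply (mulRsq m n) (mulRsq m n ^ t), ← pow_succ']
    push_cast; module

theorem RsqHom_pow_apply (t : ℕ) (f : SuperPoly m n) :
    (RsqHom m n ^ t) f = (mulRsq m n ^ t) f := by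
  rw [Module.End.coe_pow, Module.End.coe_pow]; rfl

theorem Rsq_pow_injective (hm : m ≠ 0) (t : ℕ) : Function.Injective (mulRsq m n ^ t) := by
  rw [Module.End.coe_pow]; exact (mulRsq_injective hm).iterate t

theorem mem_radialHarmonic {k : ℤ} {f : SuperPoly m n} : f ∈ radialHarmonic m n k ↔
    (∃ a, euler m n a = (k - 2 : ℝ) • a ∧ mulRsq m n a = f) ∧ f ∈ harmonic m n k := by
  refine and_congr ⟨?_, ?_⟩ Iff.rfl
  · rintro ⟨a, ha, rfl⟩
    exact ⟨a, by simpa using mem_polyDeg.1 ha, rfl⟩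
  · rintro ⟨a, ha, rfl⟩
    exact ⟨a, mem_polyDeg.2 (by simpa using ha), rfl⟩

theorem mem_map_Rsq_pow {k : ℤ} {t : ℕ} {f : SuperPoly m n} :
    f ∈ (harmonic m n k).map (RsqHom m n ^ t) ↔ ∃ h ∈ harmonic m n k, (mulRsq m n ^ t) h = f := by
  simp only [Submodule.mem_map, RsqHom_pow_apply]

theorem radialHarmonic_eq (hm : m ≠ 0) {k : ℤ} {l : ℕ} (hl0 : l ≠ 0)
    (hl : 2 * (l : ℤ) = 2 * k + superDim m n - 2) : radialHarmonic m n k =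
      (harmonic m n (2 - superDim m n - k)).map (RsqHom m n ^ l) := by
  have hlR : (superDim m n : ℝ) = 2 * l - 2 * k + 2 := by
    have : ((2 * l : ℤ) : ℝ) = ((2 * k + superDim m n - 2 : ℤ) : ℝ) := by rw [hl]
    push_cast at this; linarith
  have hdeg : ((2 - superDim m n - k : ℤ) : ℝ) = k - 2 * l := by
    push_cast; rw [hlR]; ring
  ext f
  rw [mem_radialHarmonic, mem_map_Rsq_pow]
  constructor
  · rintro ⟨⟨a₀, ha₀, hf₀⟩, hfH⟩
    have key : ∀ t : ℕ, t + 1 ≤ l → ∃ a, euler m n a = (k - 2 * (t + 1) : ℝ) • a ∧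
        (mulRsq m n ^ (t + 1)) a = f ∧
        mulRsq m n (laplacian m n a) = (-(4 * (t + 1) * (l - (t + 1))) : ℝ) • a := by
      have main : ∀ (t : ℕ) (a : SuperPoly m n), euler m n a = (k - 2 * (t + 1) : ℝ) • a →
          (mulRsq m n ^ (t + 1)) a = f →
          mulRsq m n (laplacian m n a) = (-(4 * (t + 1) * (l - (t + 1))) : ℝ) • a := by
        intro t a ha haf
        have h1 := (mem_harmonic.1 hfH).2
        rw [← haf, laplacian_Rsq_pow ha, pow_succ, Module.End.mul_apply, ← map_smul, ← map_add] at h1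
        have h2 := Rsq_pow_injective hm t (h1.trans (map_zero _).symm)
        rw [eq_neg_of_add_eq_zero_left h2, hlR]
        module
      intro t
      induction t with
      | zero =>
        intro _
        have ha : euler m n a₀ = (k - 2 * ((0 : ℕ) + 1) : ℝ) • a₀ := by
          rw [ha₀]; push_cast; module
        have haf : (mulRsq m n ^ (0 + 1)) a₀ = f := by rw [zero_add, pow_one, hf₀]
        exact ⟨a₀, ha, haf, main 0 a₀ ha haf⟩
      | succ t ih =>
        intro ht
        obtain ⟨a, ha, haf, hR⟩ := ih (by omega)
        have hc : (-(4 * (t + 1) * (l - (t + 1))) : ℝ) ≠ 0 := by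
          have : (t + 1 : ℝ) < l := by exact_mod_cast (show t + 1 < l by omega)
          have h1 : 0 < (l - (t + 1) : ℝ) := by linarith
          exact neg_ne_zero.2 (by positivity)
        set c : ℝ := -(4 * (t + 1) * (l - (t + 1))) with hcdef
        have hb : mulRsq m n (c⁻¹ • laplacian m n a) = a := by
          rw [map_smul, hR, smul_smul, inv_mul_cancel₀ hc, one_smul]
        have hbE : euler m n (c⁻¹ • laplacian m n a) =
            (k - 2 * ((t + 1 : ℕ) + 1) : ℝ) • (c⁻¹ • laplacian m n a) := by
          rw [map_smul, euler_laplacian, ha, map_smul]; push_cast; module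
        have hbf : (mulRsq m n ^ (t + 1 + 1)) (c⁻¹ • laplacian m n a) = f := by
          rw [pow_succ, Module.End.mul_apply, hb, haf]
        exact ⟨_, hbE, hbf, main (t + 1) _ hbE hbf⟩
    obtain ⟨t, rfl⟩ := Nat.exists_eq_succ_of_ne_zero hl0
    obtain ⟨a, ha, haf, hR⟩ := key t le_rfl
    refine ⟨a, mem_harmonic.2 ⟨?_, mulRsq_injective hm ?_⟩, haf⟩
    · rw [hdeg, ha]; push_cast; rfl
    · rw [hR, map_zero]; push_cast; simp
  · rintro ⟨h, hh, rfl⟩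
    obtain ⟨h1, h2⟩ := mem_harmonic.1 hh
    rw [hdeg] at h1
    obtain ⟨t, rfl⟩ := Nat.exists_eq_succ_of_ne_zero hl0
    refine ⟨⟨(mulRsq m n ^ t) h, ?_, ?_⟩, mem_harmonic.2 ⟨?_, ?_⟩⟩
    · rw [euler_Rsq_pow h1]; push_cast; module
    · rw [← Module.End.mul_apply, ← pow_succ']
    · rw [euler_Rsq_pow h1]; push_cast; module
    · rw [Nat.succ_eq_add_one, laplacian_Rsq_pow h1, h2, hlR, map_zero]; push_cast; module

/-! ### Parity -/

theorem parity_tmul (p : MvPolynomial (Fin m) ℝ) (w : ExteriorAlgebra ℝ (Fin 2 × Fin n → ℝ)) :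
    parity m n (tmul p w) = tmul p (CliffordAlgebra.involute w) := rfl

theorem parity_mulX_inl (i : Fin m) (f : SuperPoly m n) :
    parity m n (mulX (Sum.inl i) f) = mulX (Sum.inl i) (parity m n f) :=
  LinearMap.congr_fun (end_ext (D := parity m n * mulX (Sum.inl i))
    (D' := mulX (Sum.inl i) * parity m n) fun _ _ => rfl) f

theorem parity_mulX_inr (s : Fin 2 × Fin n) (f : SuperPoly m n) :
    parity m n (mulX (Sum.inr s) f) = -mulX (Sum.inr s) (parity m n f) :=
  LinearMap.congr_fun (end_ext (D := parity m n * mulX (Sum.inr s))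
    (D' := -(mulX (Sum.inr s) * parity m n)) fun p w => by
      rw [Module.End.mul_apply, LinearMap.neg_apply, Module.End.mul_apply, mulX_inr_tmul,
        parity_tmul, parity_tmul, mulX_inr_tmul, map_mul, ← tmul_neg, ← neg_mul]
      congr 2
      exact CliffordAlgebra.involute_ι _) f

theorem parity_dX_inl (i : Fin m) (f : SuperPoly m n) :
    parity m n (dX (Sum.inl i) f) = dX (Sum.inl i) (parity m n f) :=
  LinearMap.congr_fun (end_ext (D := parity m n * dX (Sum.inl i))
    (D' := dX (Sum.inl i) * parity m n) fun _ _ => rfl) f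

theorem parity_dX_inr (s : Fin 2 × Fin n) (f : SuperPoly m n) :
    parity m n (dX (Sum.inr s) f) = -dX (Sum.inr s) (parity m n f) := by
  have hd : ∀ (t : Fin 2 × Fin n) (g : SuperPoly m n), dX (Sum.inr s) (mulX (Sum.inr t) g) =
      (if s = t then (1 : ℝ) else 0) • g - mulX (Sum.inr t) (dX (Sum.inr s) g) := fun t g => by
    rw [← Module.End.mul_apply, dX_mul_mulX]
    simp only [sgn, Sum.inr.injEq, LinearMap.add_apply, LinearMap.smul_apply, Module.End.one_apply,
      Module.End.mul_apply, LinearMap.neg_apply, neg_smul, one_smul, sub_eq_add_neg]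
  have htop := eq_top_of_mulX_mem (LinearMap.ker
    (parity m n * dX (Sum.inr s) + dX (Sum.inr s) * parity m n : Module.End ℝ (SuperPoly m n))) ?_ ?_
  · have hf : f ∈ (⊤ : Submodule ℝ (SuperPoly m n)) := Submodule.mem_top
    rw [← htop] at hf
    exact eq_neg_of_add_eq_zero_left hf
  · rw [LinearMap.mem_ker, LinearMap.add_apply, Module.End.mul_apply, Module.End.mul_apply,
      dX_tmul_one, parity_tmul, map_one, dX_tmul_one, map_zero, add_zero]
  · intro a g hg
    rw [LinearMap.mem_ker, LinearMap.add_apply, Module.End.mul_apply, Module.End.mul_apply] at hg ⊢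
    have hg' := eq_neg_of_add_eq_zero_left hg
    rcases a with a | t
    · rw [dX_mulX_inl_of_ne (by simp), parity_mulX_inl, parity_mulX_inl,
        dX_mulX_inl_of_ne (by simp), hg', map_neg, neg_add_cancel]
    · rw [hd, map_sub, map_smul, parity_mulX_inr, parity_mulX_inr, map_neg, hd, hg', map_neg]
      abel

theorem parity_Rsq (f : SuperPoly m n) :
    parity m n (mulRsq m n f) = mulRsq m n (parity m n f) := by
  simp only [mulRsq, LinearMap.sub_apply, LinearMap.sum_apply, Module.End.mul_apply, map_sub,
    map_sum, parity_mulX_inl, parity_mulX_inr, map_neg, neg_neg]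

theorem parity_laplacian (f : SuperPoly m n) :
    parity m n (laplacian m n f) = laplacian m n (parity m n f) := by
  simp only [laplacian, LinearMap.sub_apply, LinearMap.smul_apply, LinearMap.sum_apply,
    Module.End.mul_apply, map_sub, map_smul, map_sum, parity_dX_inl, parity_dX_inr, map_neg,
    neg_neg]

theorem parity_euler (f : SuperPoly m n) :
    parity m n (euler m n f) = euler m n (parity m n f) := by
  rw [euler, LinearMap.sum_apply, LinearMap.sum_apply, map_sum]
  refine Finset.sum_congr rfl fun a _ => ?_
  rw [Module.End.mul_apply, Module.End.mul_apply]
  rcases a with a | a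
  · rw [parity_mulX_inl, parity_dX_inl]
  · rw [parity_mulX_inr, parity_dX_inr, map_neg, neg_neg]

theorem parity_mem_map {k : ℤ} {t : ℕ} {f : SuperPoly m n}
    (hf : f ∈ (harmonic m n k).map (RsqHom m n ^ t)) :
    parity m n f ∈ (harmonic m n k).map (RsqHom m n ^ t) := by
  rw [mem_map_Rsq_pow] at hf ⊢
  obtain ⟨h, hh, rfl⟩ := hf
  obtain ⟨h1, h2⟩ := mem_harmonic.1 hh
  refine ⟨parity m n h, mem_harmonic.2 ⟨?_, ?_⟩, ?_⟩
  · rw [← parity_euler, h1, map_smul]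
  · rw [← parity_laplacian, h2, map_zero]
  · clear hh h1 h2
    induction t with
    | zero => rfl
    | succ t ih =>
      rw [pow_succ', Module.End.mul_apply, Module.End.mul_apply, ih, parity_Rsq]

/-! ### The maximal submodule -/

theorem radialHarmonic_lt (hij : i ≠ j) {k : ℕ} (hk : 2 ≤ k) :
    radialHarmonic m n k < harmonic m n k := by
  refine lt_of_le_not_ge inf_le_right fun h => ?_
  obtain ⟨f, hf, hf0⟩ := exists_planeHarm_ne_zero (n := n) hij k
  obtain ⟨⟨a, -, ha⟩, -⟩ := mem_radialHarmonic.1 (h (planeHarm_le_harmonic hij hk hf))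
  exact hf0 (eq_zero_of_mem_range_Rsq hij hf ⟨a, ha⟩)

theorem le_radialHarmonic (hij : i ≠ j) {k : ℕ} (hk : k ≠ 0)
    {W : Submodule (Uosp m n) (SuperPoly m n)} (hW : W < harmonic m n k) :
    W ≤ radialHarmonic m n k := by
  have hm : m ≠ 0 := fun h => by subst h; exact i.elim0
  have h0 : ∀ f ∈ W, f ∈ planeHarm n i j k k → f = 0 := fun f hf hfp => by
    by_contra hne
    exact hW.not_ge (harmonic_le_of_planeHarm_le hij hW.le (planeHarm_le_of_mem hij hk hf hfp hne))
  intro f hf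
  obtain ⟨a, ha⟩ := le_range_Rsq hij (hW.le.trans inf_le_left) h0 hf
  refine mem_radialHarmonic.2 ⟨⟨a, mulRsq_injective hm ?_, ha⟩, hW.le hf⟩
  have h1 := (mem_harmonic.1 (hW.le hf)).1
  rw [← ha, euler_Rsq] at h1
  rw [eq_sub_of_add_eq h1, map_smul]
  module

theorem isSimpleModule_quotient {R V : Type*} [Ring R] [AddCommGroup V] [Module R V]
    {N H : Submodule R V} (hN : N < H) (hmax : ∀ W < H, W ≤ N) :
    IsSimpleModule R (H ⧸ N.submoduleOf H) := by
  rw [isSimpleModule_iff_isCoatom]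
  refine ⟨fun h => hN.not_ge (Submodule.submoduleOf_eq_top.1 h), fun B hB => ?_⟩
  by_contra hne
  have h1 : B.map H.subtype < H := by
    refine lt_of_le_of_ne (Submodule.map_subtype_le _ _) fun h => hne ?_
    refine eq_top_iff.2 fun x _ => ?_
    obtain ⟨y, hy, hyx⟩ := (h.ge x.2 : (x : V) ∈ B.map H.subtype)
    rwa [← Subtype.ext hyx]
  exact hB.not_ge fun x hx => hmax _ h1 ⟨x, hx, rfl⟩

end
end SuperPoly

theorem mainTheorem10 (m n : ℕ) (hm : m ≠ 0)
    (hM : ∃ N : ℕ, SuperPoly.superDim m n = -2 * (N : ℤ))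
    (k : ℤ) (hk₁ : 2 - SuperPoly.superDim m n / 2 ≤ k) (hk₂ : k ≤ 2 - SuperPoly.superDim m n)
    (j : ℕ) (hj : 2 * (j : ℤ) = 2 * k + SuperPoly.superDim m n - 2) :
    IsGreatest {W : Submodule (SuperPoly.Uosp m n) (SuperPoly m n) | W < SuperPoly.harmonic m n k}
      ((SuperPoly.harmonic m n (2 - SuperPoly.superDim m n - k)).map (SuperPoly.RsqHom m n ^ j)) ∧
    (∀ f ∈ (SuperPoly.harmonic m n (2 - SuperPoly.superDim m n - k)).map (SuperPoly.RsqHom m n ^ j),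
      SuperPoly.parity m n f ∈
        (SuperPoly.harmonic m n (2 - SuperPoly.superDim m n - k)).map (SuperPoly.RsqHom m n ^ j)) ∧
    SuperPoly.radialHarmonic m n k =
      (SuperPoly.harmonic m n (2 - SuperPoly.superDim m n - k)).map (SuperPoly.RsqHom m n ^ j) ∧
    IsSimpleModule (SuperPoly.Uosp m n)
      (SuperPoly.harmonic m n k ⧸
        (SuperPoly.radialHarmonic m n k).submoduleOf (SuperPoly.harmonic m n k)) := by
  obtain ⟨N, hN⟩ := hM
  have hm2 : 2 ≤ m := by
    have := hN
    rw [SuperPoly.superDim] at this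
    omega
  have hij : (⟨0, by omega⟩ : Fin m) ≠ ⟨1, by omega⟩ := by simp
  obtain ⟨k, rfl⟩ := Int.eq_ofNat_of_zero_le (show 0 ≤ k by omega)
  have hrad := SuperPoly.radialHarmonic_eq hm (show j ≠ 0 by omega) hj
  have hlt := SuperPoly.radialHarmonic_lt (n := n) hij (k := k) (by omega)
  have hmax := fun W hW =>
    SuperPoly.le_radialHarmonic (n := n) hij (k := k) (by omega) (W := W) hW
  exact ⟨hrad ▸ ⟨hlt, hmax⟩, fun f hf => SuperPoly.parity_mem_map hf, hrad,
    SuperPoly.isSimpleModule_quotient hlt hmax⟩
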